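/- For a field $F$ let $\mathsf M_F(m)$ be the number of field operations that are required to multiply two univariate polynomials over $F$ of degree less than $m$ (the minimal number of operations of a straight-line program over $F$ that does so). For a positive integer $\ell$, a *remainder black box* (modular black box) of size $\ell$ for $f\in F[x]$ is a procedure which, given any monic square-free $g\in F[x]$ of degree $m$ and any $h\in F[x]$ with $\deg h<m$, returns the remainder of $f(h)$ on division by $g$, using at most $\ell\cdot \mathsf M_F(m)$ operations in $F$; nothing is assumed about its answer or cost on other queries. A polynomial is $T$-sparse if it has at most $T$ nonzero terms. The algorithms considered are uniform randomized programs, independent of the field. They compute with integers (arithmetic and uniform random choices from finite ranges of integers are not counted), and they access elements of $F$ only by field operations, assignments of field constants, equality tests and choices of uniformly random elements of $F$, each of which counts as one field operation, and by queries to the black box, each of which counts as many field operations as the black box uses. **Theorem.** There is a Las Vegas algorithm of this kind, and there are absolute constants $C$ and $k$, such that the following holds for every finite field $F=\mathbb F_q$, all natural numbers $T,D$ with $q\ge T(T-1)D+1$, every positive integer $\ell$, every $T$-sparse $f\in\mathbb F_q[x]$ with $\deg f\le D$, and every remainder black box of size $\ell$ for $f$. On input $T,D,q$ and with access to the black box only,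 the algorithm halts with probability one, every halting run outputs the sparse representation of $f$ (the list of its nonzero coefficients together with their exponents), and with high probability it uses only $\tilde O(\ell\,T^2\log^2 D)$ field operations; precisely, with $N=\ell\,T^2\log^2\max(D,2)$, for every $\delta\in(0,1)$ the number of field operations is at most $$C\cdot\log(2/\delta)\cdot N\cdot\bigl(\log (N+2)\bigr)^{k}$$ with probability at least $1-\delta$. -/

import Mathlib

open Polynomial

universe u

/-! ### Field operations and the cost of polynomial multiplication -/

/-- The operations of a field.  Each of them counts as one field operation. -/
inductive FieldOp where
  | add
  | sub
  | mul
  | div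

/-- The value of a field operation (with the convention `x / 0 = 0`). -/
def FieldOp.eval {F : Type*} [Field F] : FieldOp → F → F → F
  | .add, x, y => x + y
  | .sub, x, y => x - y
  | .mul, x, y => x * y
  | .div, x, y => x / y

/-- One line of a straight-line program over `F`: either a constant of `F`, or a field operation
applied to the values in positions `i` and `j`. -/
inductive Gate (F : Type*) where
  | const (c : F)
  | op (o : FieldOp) (i j : ℕ)

/-- The value of a line, given the list of the inputs and of all values computed before it. -/
def Gate.eval {F : Type*} [Field F] (vals : List F) : Gate F → F
  | .const c => c
  | .op o i j => o.eval (vals.getD i 0) (vals.getD j 0)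

/-- Constants are free, and every field operation costs one. -/
def Gate.cost {F : Type*} : Gate F → ℕ
  | .const _ => 0
  | .op _ _ _ => 1

/-- A straight-line program over `F`. -/
abbrev StraightLine (F : Type*) := List (Gate F)

/-- All values that occur in the run of a straight-line program: first the inputs, then the values
of the lines, in order. -/
def StraightLine.run {F : Type*} [Field F] (P : StraightLine F) (inputs : List F) : List F :=
  P.foldl (fun vals g => vals ++ [g.eval vals]) inputs

/-- The number of field operations of a straight-line program. -/
def StraightLine.ops {F : Type*} (P : StraightLine F) : ℕ := (P.map Gate.cost).sum

/-- The straight-line program `P` multiplies polynomials of degree less than `m`: its `2 * m` inputs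
are the coefficients of the two factors, and the coefficients of the product occur, for all choices
of the factors, in fixed positions `out 0, …, out (2 * m - 2)` among its values. -/
def StraightLine.Multiplies {F : Type*} [Field F] (P : StraightLine F) (m : ℕ) : Prop :=
  ∃ out : ℕ → ℕ, ∀ a b : F[X], a.degree < m → b.degree < m → ∀ k < 2 * m - 1,
    (P.run ((List.range m).map a.coeff ++ (List.range m).map b.coeff)).getD (out k) 0
      = (a * b).coeff k

/-- `mulCost F m` is the number of field operations that are required to multiply two univariate
polynomials over `F` of degree less than `m`. -/
noncomputable def mulCost (F : Type*) [Field F] (m : ℕ) : ℕ :=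
  sInf {n | ∃ P : StraightLine F, P.Multiplies m ∧ P.ops = n}

/-! ### Remainder black boxes -/

/-- A remainder black box of size `ℓ` for the univariate polynomial `f`: given a monic square-free
`g` and an `h` with `deg h < deg g`, it returns `f(h) rem g` and uses `ops g h` field operations, at
most `ℓ` times the cost of multiplication in degree less than `deg g`.  Nothing is promised about
its answer or its cost on any other query. -/
structure RemainderBlackBox {F : Type*} [Field F] (f : F[X]) (ℓ : ℕ) where
  /-- The answer of the black box. -/
  answer : F[X] → F[X] → F[X]
  /-- The number of field operations that the black box uses for a query. -/
  ops : F[X] → F[X] → ℕ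
  answer_eq : ∀ g h : F[X], g.Monic → Squarefree g → h.degree < g.degree →
    answer g h = f.comp h %ₘ g
  ops_le : ∀ g h : F[X], g.Monic → Squarefree g → h.degree < g.degree →
    ops g h ≤ ℓ * mulCost F g.natDegree

/-! ### Randomized programs over a field

A program is a piece of text that does not mention any field.  It works on integer arrays and on
field arrays, both named by natural numbers.  It has no access to field elements other than through
field operations, equality tests and the black box. -/

/-- Integer expressions: literals, array entries (the index may itself be an expression), arithmetic
operations of `ℕ` (with truncated subtraction and integer division), and comparisons, which have the
value `1` or `0`. -/
inductive NatExp where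
  | lit (n : ℕ)
  | get (a : ℕ) (i : NatExp)
  | add (e₁ e₂ : NatExp)
  | sub (e₁ e₂ : NatExp)
  | mul (e₁ e₂ : NatExp)
  | div (e₁ e₂ : NatExp)
  | mod (e₁ e₂ : NatExp)
  | lt (e₁ e₂ : NatExp)
  | eq (e₁ e₂ : NatExp)

/-- The value of an integer expression when the integer arrays have the contents `ν`. -/
def NatExp.eval (ν : ℕ → ℕ → ℕ) : NatExp → ℕ
  | .lit n => n
  | .get a i => ν a (i.eval ν)
  | .add e₁ e₂ => e₁.eval ν + e₂.eval ν
  | .sub e₁ e₂ => e₁.eval ν - e₂.eval ν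
  | .mul e₁ e₂ => e₁.eval ν * e₂.eval ν
  | .div e₁ e₂ => e₁.eval ν / e₂.eval ν
  | .mod e₁ e₂ => e₁.eval ν % e₂.eval ν
  | .lt e₁ e₂ => if e₁.eval ν < e₂.eval ν then 1 else 0
  | .eq e₁ e₂ => if e₁.eval ν = e₂.eval ν then 1 else 0

/-- Randomized programs with a black box. -/
inductive Program where
  /-- do nothing -/
  | skip
  /-- first `p`, then `p'` -/
  | seq (p p' : Program)
  /-- if `e ≠ 0` then `p` else `p'` -/
  | ite (e : NatExp) (p p' : Program)
  /-- while `e ≠ 0` do `p` -/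
  | loop (e : NatExp) (p : Program)
  /-- integer assignment `a[i] := e` -/
  | assign (a : ℕ) (i e : NatExp)
  /-- `a[i] :=` a uniformly random integer from `{0, …, e}` -/
  | randNat (a : ℕ) (i e : NatExp)
  /-- field assignment `a[i] := 0` -/
  | fieldZero (a : ℕ) (i : NatExp)
  /-- field assignment `a[i] := 1` -/
  | fieldOne (a : ℕ) (i : NatExp)
  /-- field assignment `a[i] := b[j] o c[k]` -/
  | fieldOp (o : FieldOp) (a : ℕ) (i : NatExp) (b : ℕ) (j : NatExp) (c : ℕ) (k : NatExp)
  /-- `a[i] :=` a uniformly random field element -/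
  | fieldRand (a : ℕ) (i : NatExp)
  /-- integer assignment `a[i] := 1` if the field elements `b[j]` and `c[k]` are equal, and
  `a[i] := 0` otherwise -/
  | fieldTest (a : ℕ) (i : NatExp) (b : ℕ) (j : NatExp) (c : ℕ) (k : NatExp)
  /-- query the black box: with `m` the value of `e`, the modulus is the monic polynomial of degree
  `m` whose lower coefficients are `b[0], …, b[m-1]`, the argument is the polynomial with
  coefficients `c[0], …, c[m-1]`, and the coefficients of the answer go to `a[0], …, a[m-1]` -/
  | query (a b c : ℕ) (e : NatExp)

/-- A memory state: integer arrays, field arrays, and the number of field operations so far. -/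
structure State (F : Type*) where
  nat : ℕ → ℕ → ℕ
  fld : ℕ → ℕ → F
  cost : ℕ

/-- Write one entry of an array. -/
def writeEntry {V : Type*} (μ : ℕ → ℕ → V) (a i : ℕ) (v : V) : ℕ → ℕ → V :=
  fun a' i' => if a' = a ∧ i' = i then v else μ a' i'

/-- Integer assignment that is accounted for with `w` field operations. -/
def State.setNat {F : Type*} (s : State F) (a i v w : ℕ) : State F :=
  { s with nat := writeEntry s.nat a i v, cost := s.cost + w }

/-- Field assignment, accounted for with one field operation. -/
def State.setFld {F : Type*} (s : State F) (a i : ℕ) (v : F) : State F :=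
  { s with fld := writeEntry s.fld a i v, cost := s.cost + 1 }

/-- The polynomial of degree less than `m` whose coefficients are the first `m` entries of `u`. -/
noncomputable def polyOfArray {F : Type*} [Field F] (u : ℕ → F) (m : ℕ) : F[X] :=
  ∑ i ∈ Finset.range m, monomial i (u i)

/-- The effect of a black box query. -/
noncomputable def State.query {F : Type*} [Field F] {f : F[X]} {ℓ : ℕ}
    (box : RemainderBlackBox f ℓ) (s : State F) (a b c m : ℕ) : State F :=
  let g : F[X] := X ^ m + polyOfArray (s.fld b) m
  let h : F[X] := polyOfArray (s.fld c) m
  { s with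
    fld := fun a' i => if a' = a ∧ i < m then (box.answer g h).coeff i else s.fld a' i
    cost := s.cost + box.ops g h }

/-- At most `n` rounds of the loop "while `e ≠ 0` do `body`".  The result is `none` if the loop has
not ended by then. -/
noncomputable def execLoop {F : Type*} (e : NatExp)
    (body : State F → PMF (Option (State F))) : ℕ → State F → PMF (Option (State F))
  | 0, s => if e.eval s.nat = 0 then PMF.pure (some s) else PMF.pure none
  | n + 1, s =>
      if e.eval s.nat = 0 then PMF.pure (some s)
      else (body s).bind fun r => r.elim (PMF.pure none) (execLoop e body n)

open Classical in
/-- The distribution of the final state of a program that is started in a given state, where every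
execution of a loop is cut off after `n` rounds; the result is `none` for a run that is cut off.
A run of the program halts if and only if it is not cut off for all large `n`.

Integer computations are free, as only operations of the field are counted.  Field assignments,
field operations, equality tests of field elements and random choices of field elements cost one
field operation each, and a query costs what the black box uses. -/
noncomputable def Program.exec {F : Type*} [Field F] [Fintype F] {f : F[X]} {ℓ : ℕ}
    (box : RemainderBlackBox f ℓ) (n : ℕ) : Program → State F → PMF (Option (State F))
  | .skip => fun s => PMF.pure (some s)
  | .seq p p' => fun s => (p.exec box n s).bind fun r => r.elim (PMF.pure none) (p'.exec box n)
  | .ite e p p' => fun s => if e.eval s.nat ≠ 0 then p.exec box n s else p'.exec box n s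
  | .loop e p => execLoop e (p.exec box n) n
  | .assign a i e => fun s => PMF.pure (some (s.setNat a (i.eval s.nat) (e.eval s.nat) 0))
  | .randNat a i e => fun s =>
      (PMF.uniformOfFintype (Fin (e.eval s.nat + 1))).map
        fun v => some (s.setNat a (i.eval s.nat) v 0)
  | .fieldZero a i => fun s => PMF.pure (some (s.setFld a (i.eval s.nat) 0))
  | .fieldOne a i => fun s => PMF.pure (some (s.setFld a (i.eval s.nat) 1))
  | .fieldOp o a i b j c k => fun s =>
      PMF.pure (some (s.setFld a (i.eval s.nat)
        (o.eval (s.fld b (j.eval s.nat)) (s.fld c (k.eval s.nat)))))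
  | .fieldRand a i => fun s =>
      (PMF.uniformOfFintype F).map fun v => some (s.setFld a (i.eval s.nat) v)
  | .fieldTest a i b j c k => fun s =>
      PMF.pure (some (s.setNat a (i.eval s.nat)
        (if s.fld b (j.eval s.nat) = s.fld c (k.eval s.nat) then 1 else 0) 1))
  | .query a b c e => fun s => PMF.pure (some (s.query box a b c (e.eval s.nat)))

/-- The input state: the numbers `T`, `D`, `q` are the first entries of the integer arrays `0`, `1`,
`2`, everything else is zero, and no field operation has been used. -/
def inputState (F : Type*) [Field F] (T D q : ℕ) : State F where
  nat := fun a i => if i = 0 then (if a = 0 then T else if a = 1 then D else if a = 2 then q else 0)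
    else 0
  fld := fun _ _ => 0
  cost := 0

/-- The state `s` holds the sparse representation `f = ∑ i < t, cᵢ X ^ eᵢ`, with nonzero
coefficients and distinct exponents, as output: `t` is the first entry of the integer array `3`,
the exponents are in the integer array `4`, and the coefficients are in the field array `0`. -/
def State.Outputs {F : Type*} [Field F] (s : State F) (f : F[X]) : Prop :=
  (∀ i < s.nat 3 0, s.fld 0 i ≠ 0) ∧
  (∀ i < s.nat 3 0, ∀ j < s.nat 3 0, s.nat 4 i = s.nat 4 j → i = j) ∧
  f = ∑ i ∈ Finset.range (s.nat 3 0), monomial (s.nat 4 i) (s.fld 0 i)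

/-- The quantity `ℓ T² log² D`, where `D` is replaced by `2` if it is smaller. -/
noncomputable def costParam (ℓ T D : ℕ) : ℝ :=
  ℓ * (T : ℝ) ^ 2 * Real.log (max D 2 : ℕ) ^ 2

/-! Only field operations are counted, so a deterministic program suffices: it may examine every
exponent up to `D` with free integer arithmetic, and has to economize on queries only.

Choose `B` with `D < 2 ^ B ≤ 2 * D + 1`. For a prime `p` not dividing `q`, the polynomial `X ^ p -
1` is square-free, and a query with `h = X` returns `f` with its exponents reduced modulo `p`. Fix
`e ≤ D`. A prime at which another exponent `e'` of `f` collides with `e` divides the nonzero number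
`|e - e'| < 2 ^ B`, which has at most `B` prime divisors. So at most `T * B` primes are bad for `e`
(`card_not_isolated_le`); at the others the coefficient at `e % p` is exactly that of `e` in `f`.
With `2 * T * B + 1` primes a majority vote decides whether `e` occurs (`lt_votes_iff`), and a prime
without collisions exists for each exponent (`exists_isolated`); it is recognized by not dividing
the product of the differences of exponents (`isolated_iff`), and the coefficient is read off there.

There are `O(T log D)` queries, in degrees quasi-linear in `T log D` by a Chebyshev estimate
(`exists_lt_primeCounting`). The bound `ℓ T² log² D` up to logarithms then requires that `mulCost F
m` be quasi-linear in `m` over every field. This is proved by a Schönhage–Strassen recursion in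
radix 2, or 3 in characteristic 2 (`MulBound.step`, `exists_mulCost_le`): polynomials are cut into
blocks, and the blocks are convolved over `F[x] / (x ^ M - 1)`, where powers of `x` are roots of
unity by which multiplication is free. -/

/-! ### Computations with straight-line programs -/

section Derives

variable {Ω F : Type*} [Field F]

/-- `Derives S n U`: starting from the functions in `S`, all functions in `U` can be computed with
at most `n` field operations. -/
inductive Derives (S : Set (Ω → F)) : ℕ → Set (Ω → F) → Prop
  | refl : Derives S 0 S
  | const {n U} (c : F) : Derives S n U → Derives S n (insert (fun _ => c) U)
  | op {n U f g} (o : FieldOp) : Derives S n U → f ∈ U → g ∈ U →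
      Derives S (n + 1) (insert (fun x => o.eval (f x) (g x)) U)
  | weaken {n m U} : Derives S n U → n ≤ m → Derives S m U

theorem Derives.subset {S U : Set (Ω → F)} {n : ℕ} (h : Derives S n U) : S ⊆ U := by
  induction h with
  | refl => exact subset_rfl
  | const c _ ih => exact ih.trans (Set.subset_insert _ _)
  | op o _ _ _ ih => exact ih.trans (Set.subset_insert _ _)
  | weaken _ _ ih => exact ih

theorem Derives.trans {S U V : Set (Ω → F)} {n m : ℕ} (h : Derives S n U) (h' : Derives U m V) :
    Derives S (n + m) V := by
  induction h' with
  | refl => exact h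
  | const c _ ih => exact ih.const c
  | op o _ hf hg ih => exact ih.op o hf hg
  | weaken _ hle ih => exact ih.weaken (Nat.add_le_add_left hle _)

/-- Repeating a computation for every member of a finite family. -/
theorem Derives.forall_lt {P : ℕ → Set (Ω → F) → Prop} (hP : ∀ i, Monotone (P i)) {c : ℕ}
    (k : ℕ) (S : Set (Ω → F))
    (h : ∀ i < k, ∀ U, S ⊆ U → ∃ V, Derives U c V ∧ P i V) :
    ∃ V, Derives S (k * c) V ∧ ∀ i < k, P i V := by
  induction k with
  | zero => exact ⟨S, by simpa using Derives.refl, by simp⟩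
  | succ k ih =>
    obtain ⟨U, hU, hPU⟩ := ih fun i hi => h i (hi.trans k.lt_succ_self)
    obtain ⟨V, hV, hPV⟩ := h k k.lt_succ_self U hU.subset
    refine ⟨V, by simpa [Nat.succ_mul] using hU.trans hV, fun i hi => ?_⟩
    rcases Nat.lt_succ_iff_lt_or_eq.1 hi with hi | rfl
    · exact hP i hV.subset (hPU i hi)
    · exact hPV

theorem StraightLine.run_append_gate (P : StraightLine F) (g : Gate F) (inp : List F) :
    StraightLine.run (P ++ [g]) inp = P.run inp ++ [g.eval (P.run inp)] := by
  simp [StraightLine.run, List.foldl_append]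

theorem StraightLine.length_run (P : StraightLine F) (inp : List F) :
    (P.run inp).length = inp.length + P.length := by
  induction P using List.reverseRecOn with
  | nil => simp [StraightLine.run]
  | append_singleton P g ih => rw [run_append_gate]; simp [ih]; omega

/-- The return to straight-line programs. Appending a gate leaves all earlier positions in place, so
each derived function keeps one position that is independent of the input `x`. Constant gates
lengthen the program but not its cost. -/
theorem Derives.exists_straightLine (inp : Ω → List F) (L : ℕ) (hL : ∀ x, (inp x).length = L)
    {n : ℕ} {U : Set (Ω → F)}
    (h : Derives {f | ∃ i < L, f = fun x => (inp x).getD i 0} n U) :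
    ∃ P : StraightLine F, P.ops ≤ n ∧ ∀ f ∈ U, ∃ i < L + P.length,
      ∀ x, (P.run (inp x)).getD i 0 = f x := by
  have key : ∀ (P : StraightLine F) (g : Gate F) (i : ℕ) (x : Ω), i < L + P.length →
      (StraightLine.run (P ++ [g]) (inp x)).getD i 0 = (P.run (inp x)).getD i 0 := by
    intro P g i x hi
    rw [StraightLine.run_append_gate, List.getD_append]
    rwa [StraightLine.length_run, hL]
  have last : ∀ (P : StraightLine F) (g : Gate F) (x : Ω),
      (StraightLine.run (P ++ [g]) (inp x)).getD (L + P.length) 0 = g.eval (P.run (inp x)) := by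
    intro P g x
    rw [StraightLine.run_append_gate, List.getD_append_right]
    · simp [StraightLine.length_run, hL]
    · simp [StraightLine.length_run, hL]
  induction h with
  | refl =>
    refine ⟨[], by simp [StraightLine.ops], ?_⟩
    rintro f ⟨i, hi, rfl⟩
    exact ⟨i, by simpa using hi, fun x => by simp [StraightLine.run]⟩
  | const c _ ih =>
    obtain ⟨P, hP, hU⟩ := ih
    refine ⟨P ++ [Gate.const c], by simpa [StraightLine.ops, Gate.cost] using hP, ?_⟩
    rintro f (rfl | hf)
    · exact ⟨L + P.length, by simp, fun x => by rw [last]; rfl⟩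
    · obtain ⟨i, hi, hf⟩ := hU f hf
      exact ⟨i, by simp; omega, fun x => by rw [key _ _ _ _ hi, hf]⟩
  | op o _ hf hg ih =>
    obtain ⟨P, hP, hU⟩ := ih
    obtain ⟨i, hi, hf⟩ := hU _ hf
    obtain ⟨j, hj, hg⟩ := hU _ hg
    refine ⟨P ++ [Gate.op o i j], ?_, ?_⟩
    · simpa [StraightLine.ops, Gate.cost] using hP
    rintro f (rfl | hf')
    · exact ⟨L + P.length, by simp, fun x => by rw [last, Gate.eval, hf, hg]⟩
    · obtain ⟨i, hi, hf⟩ := hU f hf'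
      exact ⟨i, by simp; omega, fun x => by rw [key _ _ _ _ hi, hf]⟩
  | weaken _ hle ih =>
    obtain ⟨P, hP, hU⟩ := ih
    exact ⟨P, hP.trans hle, hU⟩

/-- All coefficients of the polynomial-valued function `a` are among the functions in `U`. -/
def CoeffsIn (U : Set (Ω → F)) (a : Ω → F[X]) : Prop :=
  ∀ i, (fun x => (a x).coeff i) ∈ U

theorem CoeffsIn.mono {U V : Set (Ω → F)} {a : Ω → F[X]} (h : CoeffsIn U a) (hUV : U ⊆ V) :
    CoeffsIn V a := fun i => hUV (h i)

/-- Two polynomials of degree less than `n`, given by their coefficients, can be multiplied with at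
most `c` field operations. -/
def MulBound (F : Type u) [Field F] (n c : ℕ) : Prop :=
  ∀ (Ω : Type u) (S : Set (Ω → F)) (a b : Ω → F[X]), (fun _ => 0) ∈ S →
    (∀ x, (a x).degree < n) → (∀ x, (b x).degree < n) → CoeffsIn S a → CoeffsIn S b →
    ∃ U, Derives S c U ∧ CoeffsIn U (fun x => a x * b x)

end Derives

/-- With `Ω` the set of all admissible pairs of factors, one derivation is one program for all of
them. Coefficients from `n` on are supplied by the constant `0`, which is free. -/
theorem mulCost_le {F : Type u} [Field F] {n c : ℕ} (h : MulBound F n c) :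
    mulCost F n ≤ c := by
  let Ω := {p : F[X] × F[X] // p.1.degree < n ∧ p.2.degree < n}
  let inp : Ω → List F := fun p =>
    (List.range n).map p.1.1.coeff ++ (List.range n).map p.1.2.coeff
  have hL : ∀ x, (inp x).length = 2 * n := fun x => by simp [inp]; omega
  let S₀ : Set (Ω → F) := {f | ∃ i < 2 * n, f = fun x => (inp x).getD i 0}
  have hS : Derives S₀ 0 (insert (fun _ => 0) S₀) := Derives.refl.const 0
  have ha : CoeffsIn (insert (fun _ => 0) S₀) fun x : Ω => x.1.1 := by
    intro i
    by_cases hi : i < n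
    · refine Or.inr ⟨i, by omega, funext fun x => ?_⟩
      rw [List.getD_append _ _ _ _ (by simpa using hi)]; simp [hi]
    · exact Or.inl (funext fun x => coeff_eq_zero_of_degree_lt
        (x.2.1.trans_le (by exact_mod_cast not_lt.1 hi)))
  have hb : CoeffsIn (insert (fun _ => 0) S₀) fun x : Ω => x.1.2 := by
    intro i
    by_cases hi : i < n
    · refine Or.inr ⟨n + i, by omega, funext fun x => ?_⟩
      rw [List.getD_append_right _ _ _ _ (by simp)]; simp [hi]
    · exact Or.inl (funext fun x => coeff_eq_zero_of_degree_lt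
        (x.2.2.trans_le (by exact_mod_cast not_lt.1 hi)))
  obtain ⟨U, hU, hab⟩ := h Ω _ _ _ (Set.mem_insert _ _) (fun x => x.2.1) (fun x => x.2.2) ha hb
  obtain ⟨P, hP, hPU⟩ := (hS.trans hU).exists_straightLine inp _ hL
  choose out hout using fun k => hPU _ (hab k)
  have hmul : P.Multiplies n :=
    ⟨out, fun a b hda hdb k _ => (hout k).2 ⟨(a, b), hda, hdb⟩⟩
  have hmem : P.ops ∈ {c | ∃ P : StraightLine F, P.Multiplies n ∧ P.ops = c} := ⟨P, hmul, rfl⟩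
  exact (Nat.sInf_le hmem).trans (by simpa using hP)

theorem degree_mul_lt_add {F : Type*} [Field F] {a b : F[X]} {n m : ℕ} (ha : a.degree < n)
    (hb : b.degree < m) : (a * b).degree < (n + m : ℕ) := by
  rcases eq_or_ne a 0 with rfl | h
  · rw [zero_mul, degree_zero]
    exact WithBot.bot_lt_coe _
  rcases eq_or_ne b 0 with rfl | h'
  · rw [mul_zero, degree_zero]
    exact WithBot.bot_lt_coe _
  rw [degree_eq_natDegree h, Nat.cast_lt] at ha
  rw [degree_eq_natDegree h', Nat.cast_lt] at hb
  rw [degree_eq_natDegree (mul_ne_zero h h'), natDegree_mul h h', Nat.cast_lt]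
  omega

/-! ### Coefficientwise computations and the school method -/

section ScalarComputations

variable {Ω F : Type*} [Field F]

theorem Derives.exists_sum {S : Set (Ω → F)} (h0 : (fun _ => 0) ∈ S) {f : ℕ → Ω → F} (k : ℕ)
    (hf : ∀ i < k, f i ∈ S) :
    ∃ U, Derives S k U ∧ (fun x => ∑ i ∈ Finset.range k, f i x) ∈ U := by
  induction k with
  | zero => exact ⟨S, Derives.refl, by simpa using h0⟩
  | succ k ih =>
    obtain ⟨U, hU, hsum⟩ := ih fun i hi => hf i (hi.trans k.lt_succ_self)
    refine ⟨_, hU.op .add hsum (hU.subset (hf k k.lt_succ_self)), Or.inl ?_⟩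
    simp [Finset.sum_range_succ, FieldOp.eval]

theorem Derives.exists_sum_mul {S : Set (Ω → F)} (h0 : (fun _ => 0) ∈ S) {f g : ℕ → Ω → F} (k : ℕ)
    (hf : ∀ i < k, f i ∈ S) (hg : ∀ i < k, g i ∈ S) :
    ∃ U, Derives S (2 * k) U ∧ (fun x => ∑ i ∈ Finset.range k, f i x * g i x) ∈ U := by
  induction k with
  | zero => exact ⟨S, Derives.refl, by simpa using h0⟩
  | succ k ih =>
    obtain ⟨U, hU, hsum⟩ := ih (fun i hi => hf i (hi.trans k.lt_succ_self))
      fun i hi => hg i (hi.trans k.lt_succ_self)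
    have h1 := hU.op .mul (hU.subset (hf k k.lt_succ_self)) (hU.subset (hg k k.lt_succ_self))
    refine ⟨_, h1.op .add (Set.mem_insert_of_mem _ hsum) (Set.mem_insert _ _), Or.inl ?_⟩
    simp [Finset.sum_range_succ, FieldOp.eval]

/-- If each of the coefficients of `a` at `s, …, s + n - 1` can be computed with `c` operations and
the others are known, then `a` can be computed with `n * c` operations. -/
theorem CoeffsIn.of_forall {S : Set (Ω → F)} {a : Ω → F[X]} (s n c : ℕ)
    (hout : ∀ i, (i < s ∨ s + n ≤ i) → (fun x => (a x).coeff i) ∈ S)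
    (h : ∀ i < n, ∀ U, S ⊆ U → ∃ V, Derives U c V ∧ (fun x => (a x).coeff (s + i)) ∈ V) :
    ∃ U, Derives S (n * c) U ∧ CoeffsIn U a := by
  obtain ⟨U, hU, hPU⟩ := Derives.forall_lt
    (P := fun i V => (fun x => (a x).coeff (s + i)) ∈ V) (fun i U V hUV hU => hUV hU) n S h
  refine ⟨U, hU, fun i => ?_⟩
  by_cases hi : i < s ∨ s + n ≤ i
  · exact hU.subset (hout i hi)
  · obtain ⟨j, rfl⟩ := Nat.exists_eq_add_of_le (show s ≤ i by omega)
    exact hPU j (by omega)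

theorem CoeffsIn.of_forall_lt {S : Set (Ω → F)} (h0 : (fun _ => 0) ∈ S) {a : Ω → F[X]} (n c : ℕ)
    (ha : ∀ x, (a x).degree < n)
    (h : ∀ i < n, ∀ U, S ⊆ U → ∃ V, Derives U c V ∧ (fun x => (a x).coeff i) ∈ V) :
    ∃ U, Derives S (n * c) U ∧ CoeffsIn U a := by
  refine CoeffsIn.of_forall 0 n c (fun i hi => ?_) (by simpa using h)
  convert h0 using 2 with x
  exact coeff_eq_zero_of_degree_lt ((ha x).trans_le (by exact_mod_cast (by omega)))

/-- A multiplication by the school method. -/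
theorem mulBound_naive (F : Type u) [Field F] (n : ℕ) : MulBound F n (2 * n * (2 * (2 * n))) := by
  intro Ω S a b h0 ha hb hSa hSb
  refine CoeffsIn.of_forall_lt h0 (2 * n) _ (fun x => ?_) fun i hi U hU => ?_
  · rw [two_mul]
    exact degree_mul_lt_add (ha x) (hb x)
  · obtain ⟨V, hV, h⟩ := Derives.exists_sum_mul (hU h0)
      (f := fun j x => (a x).coeff j) (g := fun j x => (b x).coeff (i - j)) (i + 1)
      (fun j _ => hU (hSa j)) fun j _ => hU (hSb (i - j))
    refine ⟨V, hV.weaken (by omega), ?_⟩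
    convert h using 2 with x
    rw [coeff_mul, Finset.Nat.sum_antidiagonal_eq_sum_range_succ_mk]

theorem MulBound.mono {F : Type u} [Field F] {n m c d : ℕ} (h : MulBound F n c) (hmn : m ≤ n)
    (hcd : c ≤ d) : MulBound F m d := by
  intro Ω S a b h0 ha hb hSa hSb
  obtain ⟨U, hU, hab⟩ := h Ω S a b h0 (fun x => (ha x).trans_le (by exact_mod_cast hmn))
    (fun x => (hb x).trans_le (by exact_mod_cast hmn)) hSa hSb
  exact ⟨U, hU.weaken hcd, hab⟩

end ScalarComputations

/-! ### Computations in the ring `F[x] / (x ^ M - 1)` -/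

section CyclicRing

variable {F : Type*} [Field F]

/-- The polynomial of degree less than `M` that is congruent modulo `X ^ M - 1` to the polynomial
`p` of degree less than `2 * M`. -/
noncomputable def foldPoly (M : ℕ) (p : F[X]) : F[X] :=
  ∑ i ∈ Finset.range M, monomial i (p.coeff i + p.coeff (i + M))

theorem coeff_foldPoly (M : ℕ) (p : F[X]) (i : ℕ) :
    (foldPoly M p).coeff i = if i < M then p.coeff i + p.coeff (i + M) else 0 := by
  simp only [foldPoly, finsetSum_coeff, coeff_monomial, Finset.sum_ite_eq', Finset.mem_range]

theorem degree_foldPoly_lt (M : ℕ) (p : F[X]) : (foldPoly M p).degree < M := by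
  rw [degree_lt_iff_coeff_zero]
  intro i hi
  rw [coeff_foldPoly, if_neg (by omega)]

/-- The ring `F[x] / (x ^ M - 1)`. -/
abbrev CyclicRing (F : Type*) [Field F] (M : ℕ) := AdjoinRoot (X ^ M - 1 : F[X])

theorem root_pow_eq_one (M : ℕ) : (AdjoinRoot.root (X ^ M - 1 : F[X])) ^ M = 1 := by
  have h := AdjoinRoot.mk_self (f := (X ^ M - 1 : F[X]))
  rwa [map_sub, map_pow, AdjoinRoot.mk_X, map_one, sub_eq_zero] at h

theorem mk_foldPoly {M : ℕ} {p : F[X]} (hp : p.degree < (2 * M : ℕ)) :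
    AdjoinRoot.mk (X ^ M - 1) (foldPoly M p) = AdjoinRoot.mk (X ^ M - 1) p := by
  have h : p = ∑ i ∈ Finset.range (M + M), monomial i (p.coeff i) := by
    ext j
    simp only [finsetSum_coeff, coeff_monomial, Finset.sum_ite_eq', Finset.mem_range]
    split_ifs with hj
    · rfl
    · exact coeff_eq_zero_of_degree_lt (hp.trans_le (by exact_mod_cast (by omega)))
  conv_rhs => rw [h]
  simp only [Finset.sum_range_add, foldPoly, map_sum, map_add, Finset.sum_add_distrib]
  congr 1
  refine Finset.sum_congr rfl fun i _ => ?_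
  rw [← C_mul_X_pow_eq_monomial, ← C_mul_X_pow_eq_monomial]
  simp only [map_mul, map_pow, AdjoinRoot.mk_X, pow_add, root_pow_eq_one, one_mul, add_comm i M]

theorem eq_of_mk_eq_mk {M : ℕ} (hM : 0 < M) {p q : F[X]} (hp : p.degree < M) (hq : q.degree < M)
    (h : AdjoinRoot.mk (X ^ M - 1) p = AdjoinRoot.mk (X ^ M - 1) q) : p = q := by
  rw [AdjoinRoot.mk_eq_mk] at h
  refine sub_eq_zero.1 (eq_zero_of_dvd_of_degree_lt h ?_)
  have : (X ^ M - 1 : F[X]).degree = M := by simpa using degree_X_pow_sub_C hM (1 : F)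
  rw [this]
  exact (degree_sub_le _ _).trans_lt (max_lt hp hq)

/-- Equality in the quotient ring, read on representatives of degree less than `2 * M` without
reducing them first. -/
theorem coeff_add_coeff_eq {M : ℕ} {p q : F[X]} (hp : p.degree < (2 * M : ℕ))
    (hq : q.degree < (2 * M : ℕ))
    (h : AdjoinRoot.mk (X ^ M - 1) p = AdjoinRoot.mk (X ^ M - 1) q) {w : ℕ} (hw : w < M) :
    p.coeff w + p.coeff (w + M) = q.coeff w + q.coeff (w + M) := by
  rw [← mk_foldPoly hp, ← mk_foldPoly hq] at h
  have := congrArg (coeff · w)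
    (eq_of_mk_eq_mk (by omega) (degree_foldPoly_lt M p) (degree_foldPoly_lt M q) h)
  simpa [coeff_foldPoly, hw] using this

variable {Ω : Type*}

/-- The functions in `U` contain all coefficients of a representative of `Z` of degree less than
`M`. -/
def ClassIn {M : ℕ} (U : Set (Ω → F)) (Z : Ω → CyclicRing F M) : Prop :=
  ∃ a : Ω → F[X], CoeffsIn U a ∧ (∀ x, (a x).degree < M) ∧ ∀ x, AdjoinRoot.mk _ (a x) = Z x

theorem ClassIn.mono {M : ℕ} {U V : Set (Ω → F)} {Z : Ω → CyclicRing F M} (h : ClassIn U Z)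
    (hUV : U ⊆ V) : ClassIn V Z := by
  obtain ⟨a, ha, h⟩ := h
  exact ⟨a, ha.mono hUV, h⟩

/-- Multiplication by the root is a cyclic shift of the coefficients and costs no field operation.
This is what makes the Fourier transform over this ring cheap. -/
theorem ClassIn.root_mul {M : ℕ} (hM : 0 < M) {U : Set (Ω → F)} (h0 : (fun _ => 0) ∈ U)
    {Z : Ω → CyclicRing F M} (h : ClassIn U Z) :
    ClassIn U fun x => AdjoinRoot.root _ * Z x := by
  obtain ⟨a, ha, hdeg, hZ⟩ := h
  have hX : ∀ x, (X * a x).degree < ((2 * M : ℕ) : WithBot ℕ) := fun x => by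
    refine (degree_lt_iff_coeff_zero _ _).2 fun i hi => ?_
    rcases i with _ | i
    · omega
    · rw [coeff_X_mul]
      exact coeff_eq_zero_of_degree_lt ((hdeg x).trans_le (by exact_mod_cast (by omega)))
  refine ⟨fun x => foldPoly M (X * a x), fun i => ?_, fun x => degree_foldPoly_lt _ _, fun x => ?_⟩
  · simp only [coeff_foldPoly]
    split_ifs with hi
    · rcases i with _ | i
      · obtain ⟨k, rfl⟩ := Nat.exists_eq_succ_of_ne_zero hM.ne'
        simpa [coeff_X_mul] using ha k
      · convert ha i using 2 with x
        rw [coeff_X_mul, show i + 1 + M = i + M + 1 by omega, coeff_X_mul,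
          coeff_eq_zero_of_degree_lt (n := i + M), add_zero]
        exact (hdeg x).trans_le (by exact_mod_cast (by omega))
    · exact h0
  · rw [mk_foldPoly (hX x), map_mul, AdjoinRoot.mk_X, hZ]

theorem ClassIn.mul_root_pow {M : ℕ} (hM : 0 < M) {U : Set (Ω → F)} (h0 : (fun _ => 0) ∈ U)
    {Z : Ω → CyclicRing F M} (h : ClassIn U Z) (e : ℕ) :
    ClassIn U fun x => Z x * AdjoinRoot.root _ ^ e := by
  induction e with
  | zero => simpa using h
  | succ e ih =>
    convert ih.root_mul hM h0 using 2 with x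
    ring

theorem ClassIn.exists_sum {M : ℕ} {S : Set (Ω → F)} (h0 : (fun _ => 0) ∈ S)
    {Z : ℕ → Ω → CyclicRing F M} (k : ℕ) (h : ∀ i < k, ClassIn S (Z i)) :
    ∃ U, Derives S (M * k) U ∧ ClassIn U fun x => ∑ i ∈ Finset.range k, Z i x := by
  choose! a ha hdeg hZ using h
  have hd : ∀ x, (∑ i ∈ Finset.range k, a i x).degree < M := fun x =>
    (degree_lt_iff_coeff_zero _ _).2 fun i hi => by
      rw [finsetSum_coeff]
      exact Finset.sum_eq_zero fun j hj => coeff_eq_zero_of_degree_lt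
        ((hdeg j (Finset.mem_range.1 hj) x).trans_le (by exact_mod_cast hi))
  obtain ⟨U, hU, hsum⟩ := CoeffsIn.of_forall_lt h0 M k hd fun i _ U hU => by
    simp only [finsetSum_coeff]
    exact Derives.exists_sum (f := fun j x => (a j x).coeff i) (hU h0) k
      fun j hj => hU (ha j hj i)
  refine ⟨U, hU, _, hsum, hd, fun x => ?_⟩
  rw [map_sum]
  exact Finset.sum_congr rfl fun j hj => hZ j (Finset.mem_range.1 hj) x

end CyclicRing

/-- The product of the representatives costs `c`; folding it back to degree less than `M` costs one
addition per coefficient. -/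
theorem ClassIn.exists_mul {F : Type u} [Field F] {Ω : Type u} {M c : ℕ} (hc : MulBound F M c)
    {S : Set (Ω → F)} (h0 : (fun _ => 0) ∈ S) {Z W : Ω → CyclicRing F M} (hZ : ClassIn S Z)
    (hW : ClassIn S W) : ∃ U, Derives S (c + M) U ∧ ClassIn U fun x => Z x * W x := by
  obtain ⟨a, ha, hda, hZ⟩ := hZ
  obtain ⟨b, hb, hdb, hW⟩ := hW
  obtain ⟨U, hU, hab⟩ := hc Ω S a b h0 hda hdb ha hb
  have hdeg : ∀ x, (a x * b x).degree < (2 * M : ℕ) := fun x => by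
    rw [two_mul]
    exact degree_mul_lt_add (hda x) (hdb x)
  obtain ⟨V, hV, hf⟩ := CoeffsIn.of_forall_lt (hU.subset h0)
    (a := fun x => foldPoly M (a x * b x)) M 1 (fun x => degree_foldPoly_lt _ _) fun i hi V hUV =>
      ⟨_, Derives.refl.op .add (hUV (hab i)) (hUV (hab (i + M))), Or.inl <| by
        simp [coeff_foldPoly, hi, FieldOp.eval]⟩
  refine ⟨V, by simpa using hU.trans hV, _, hf, fun x => degree_foldPoly_lt _ _, fun x => ?_⟩
  rw [mk_foldPoly (hdeg x), map_mul, hZ, hW]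

/-! ### The discrete Fourier transform -/

theorem Finset.sum_range_mul_eq {A : Type*} [AddCommMonoid A] (g : ℕ → A) (n r : ℕ) :
    ∑ u ∈ Finset.range (n * r), g u
      = ∑ v ∈ Finset.range r, ∑ w ∈ Finset.range n, g (w * r + v) := by
  rw [Finset.sum_comm]
  induction n with
  | zero => simp
  | succ n ih => rw [Nat.succ_mul, Finset.sum_range_add, ih, Finset.sum_range_succ]

/-- The Cooley–Tukey recursion in radix `r`. Writing `u = w * r + v` splits the sum into `r`
transforms of length `r ^ j` with root `ζ ^ r`; each output is then a sum of `r` of their values,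
shifted by powers of the root for free. Only `ζ ^ r ^ j = 1` is needed for the forward transform,
not primitivity of `ζ`. -/
theorem ClassIn.exists_dft {Ω F : Type*} [Field F] {M : ℕ} (hM : 0 < M) {r : ℕ} (hr : 0 < r) :
    ∀ (j e : ℕ), (AdjoinRoot.root (X ^ M - 1 : F[X]) ^ e) ^ r ^ j = 1 →
    ∀ (S : Set (Ω → F)), (fun _ => 0) ∈ S → ∀ (Z : ℕ → Ω → CyclicRing F M),
    (∀ u < r ^ j, ClassIn S (Z u)) →
    ∃ U, Derives S (j * r ^ j * (M * r)) U ∧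
      ∀ i, ClassIn U fun x => ∑ u ∈ Finset.range (r ^ j),
        Z u x * (AdjoinRoot.root (X ^ M - 1 : F[X]) ^ e) ^ (i * u) := by
  intro j
  induction j with
  | zero =>
    intro e _ S _ Z hZ
    exact ⟨S, by simpa using Derives.refl, fun i => by simpa using hZ 0 (by simp)⟩
  | succ j ih =>
    intro e hζ S h0 Z hZ
    set ζ := AdjoinRoot.root (X ^ M - 1 : F[X]) ^ e with hζe
    obtain ⟨U, hU, hin⟩ := Derives.forall_lt
      (P := fun v V => ∀ i, ClassIn V fun x => ∑ w ∈ Finset.range (r ^ j),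
        Z (w * r + v) x * (ζ ^ r) ^ (i * w))
      (fun v V V' hV h i => (h i).mono hV) (c := j * r ^ j * (M * r)) r S
      (fun v hv V hV => by
        have h := ih (e * r) (by rw [pow_mul, ← pow_mul _ r, ← pow_succ']; exact hζ) V (hV h0)
          (fun w => Z (w * r + v)) (fun w hw => (hZ _ ?_).mono hV)
        · rwa [pow_mul] at h
        · calc w * r + v < (w + 1) * r := by rw [Nat.succ_mul]; omega
            _ ≤ r ^ j * r := Nat.mul_le_mul_right _ hw
            _ = r ^ (j + 1) := (pow_succ _ _).symm)
    obtain ⟨V, hV, hout⟩ := Derives.forall_lt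
      (P := fun i V => ClassIn V fun x => ∑ u ∈ Finset.range (r ^ (j + 1)), Z u x * ζ ^ (i * u))
      (fun v V V' hV h => h.mono hV) (c := M * r) (r ^ (j + 1)) U
      (fun i _ W hW => by
        obtain ⟨W', hW', h⟩ := ClassIn.exists_sum (hW (hU.subset h0))
          (Z := fun v x => (∑ w ∈ Finset.range (r ^ j), Z (w * r + v) x * (ζ ^ r) ^ (i * w))
            * AdjoinRoot.root (X ^ M - 1 : F[X]) ^ (e * (i * v))) r
          (fun v hv => ((hin v hv i).mono hW).mul_root_pow hM (hW (hU.subset h0)) _)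
        refine ⟨W', hW', ?_⟩
        convert h using 2 with x
        rw [pow_succ, Finset.sum_range_mul_eq]
        refine Finset.sum_congr rfl fun v _ => ?_
        rw [Finset.sum_mul]
        refine Finset.sum_congr rfl fun w _ => ?_
        rw [hζe]
        ring)
    refine ⟨V, (hU.trans hV).weaken (le_of_eq (by ring)), fun i => ?_⟩
    -- The outputs are periodic in `i`, so the finitely many computed ones serve every index.
    convert hout (i % r ^ (j + 1)) (Nat.mod_lt _ (pow_pos hr _)) using 4 with x u
    conv_lhs => rw [← Nat.mod_add_div i (r ^ (j + 1))]
    rw [add_mul, pow_add, mul_assoc (r ^ (j + 1)), pow_mul ζ (r ^ (j + 1)), hζ, one_pow, mul_one]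

/-- The gcd of `d` and `r ^ (j + 1)` is `r ^ s` with `s ≤ j`. Bézout gives `d * m ≡ r ^ s`, and a
factor `r ^ (j - s)` does the rest. For a root of unity this exhibits `ω ^ r ^ j` as a power of `ω ^
d`. -/
theorem exists_mul_modEq_pow_pred {r : ℕ} (hr : r.Prime) (j : ℕ) {d : ℕ} (hd : ¬ r ^ (j + 1) ∣ d) :
    ∃ k, d * k ≡ r ^ j [MOD r ^ (j + 1)] := by
  obtain ⟨s, hs, hg⟩ := (Nat.dvd_prime_pow hr).1 (Nat.gcd_dvd_right d (r ^ (j + 1)))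
  have hsj : s ≤ j := by
    by_contra h
    obtain rfl : s = j + 1 := by omega
    exact hd (hg ▸ Nat.gcd_dvd_left d (r ^ (j + 1)))
  have hlt : Nat.gcd d (r ^ (j + 1)) < r ^ (j + 1) := by
    rw [hg]
    exact Nat.pow_lt_pow_right hr.one_lt (by omega)
  obtain ⟨m, -, hm⟩ := Nat.exists_mul_mod_eq_gcd hlt
  refine ⟨m * r ^ (j - s), ?_⟩
  have h : d * m ≡ r ^ s [MOD r ^ (j + 1)] := by
    rw [Nat.ModEq, hm, hg, Nat.mod_eq_of_lt (hg ▸ hlt)]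
  have := h.mul_right (r ^ (j - s))
  rwa [← pow_add, Nat.add_sub_cancel' hsj, mul_assoc] at this

/-- The sums over powers of a root of unity `ω` in a commutative ring are annihilated by
`1 - ω ^ (N / r)`, where `N` is a power of the prime `r`, except for those that are trivial. -/
theorem one_sub_mul_sum_pow_eq_zero {A : Type*} [CommRing A] {ω : A} {r : ℕ} (hr : r.Prime) (j : ℕ)
    (hω : ω ^ r ^ (j + 1) = 1) {d : ℕ} (hd : ¬ r ^ (j + 1) ∣ d) :
    (1 - ω ^ r ^ j) * ∑ i ∈ Finset.range (r ^ (j + 1)), (ω ^ d) ^ i = 0 := by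
  obtain ⟨k, hk⟩ := exists_mul_modEq_pow_pred hr j hd
  -- As `ω ^ r ^ j` is a power of `ω ^ d`, the factor `1 - ω ^ d` divides `1 - ω ^ r ^ j`; it
  -- already annihilates the geometric sum by telescoping.
  have h : ω ^ r ^ j = (ω ^ d) ^ k := by
    have hmod : ∀ n, ω ^ n = ω ^ (n % r ^ (j + 1)) := fun n => by
      conv_lhs => rw [← Nat.mod_add_div n (r ^ (j + 1)), pow_add, pow_mul, hω, one_pow, mul_one]
    rw [← pow_mul, hmod (d * k), hk, ← hmod]
  obtain ⟨c, hc⟩ := sub_dvd_pow_sub_pow (1 : A) (ω ^ d) k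
  rw [one_pow] at hc
  rw [h, hc, mul_comm (1 - ω ^ d), mul_assoc, mul_neg_geom_sum, ← pow_mul, mul_comm d, pow_mul, hω,
    one_pow, sub_self, mul_zero]

/-! ### Fast multiplication -/

/-- The convolution of two sequences of length `N`. -/
def convSeq {A : Type*} [CommRing A] (N : ℕ) (α β : ℕ → A) (v : ℕ) : A :=
  ∑ i ∈ Finset.range N, ∑ i' ∈ Finset.range N, if i + i' = v then α i * β i' else 0

/-- The usual inversion formula, with `ω ^ (N - v)` in place of `ω ^ (-v)`. The ring has zero
divisors and the sums over powers of `ω` need not vanish, so the identity is claimed only after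
multiplication by `1 - ω ^ r ^ j`. As `α` and `β` vanish from `r ^ j` on and `2 * r ^ j ≤ r ^ (j +
1)`, the cyclic convolution has no wraparound. -/
theorem inverse_dft_mul {A : Type*} [CommRing A] {ω : A} {r : ℕ} (hr : r.Prime) (j : ℕ)
    (hω : ω ^ r ^ (j + 1) = 1) {α β : ℕ → A} (hα : ∀ i, r ^ j ≤ i → α i = 0)
    (hβ : ∀ i, r ^ j ≤ i → β i = 0) {v : ℕ} (hv : v < r ^ (j + 1)) :
    (1 - ω ^ r ^ j) * ∑ u ∈ Finset.range (r ^ (j + 1)),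
      ((∑ i ∈ Finset.range (r ^ (j + 1)), α i * ω ^ (u * i)) *
        (∑ i ∈ Finset.range (r ^ (j + 1)), β i * ω ^ (u * i))) * ω ^ ((r ^ (j + 1) - v) * u)
    = (1 - ω ^ r ^ j) * ((r ^ (j + 1) : ℕ) * convSeq (r ^ (j + 1)) α β v) := by
  have h2 : 2 * r ^ j ≤ r ^ (j + 1) := by
    rw [pow_succ, mul_comm]
    exact Nat.mul_le_mul_left _ hr.two_le
  set N := r ^ (j + 1) with hN
  set κ := 1 - ω ^ r ^ j
  have h1 : κ * ∑ u ∈ Finset.range N, ((∑ i ∈ Finset.range N, α i * ω ^ (u * i)) *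
        (∑ i ∈ Finset.range N, β i * ω ^ (u * i))) * ω ^ ((N - v) * u)
      = ∑ i ∈ Finset.range N, ∑ i' ∈ Finset.range N,
        α i * β i' * (κ * ∑ u ∈ Finset.range N, (ω ^ (i + i' + (N - v))) ^ u) := by
    simp only [Finset.sum_mul_sum]
    simp only [Finset.sum_mul, Finset.mul_sum]
    rw [Finset.sum_comm]
    refine Finset.sum_congr rfl fun i _ => ?_
    rw [Finset.sum_comm]
    refine Finset.sum_congr rfl fun i' _ => Finset.sum_congr rfl fun u _ => ?_
    ring
  rw [h1, convSeq, Finset.mul_sum, Finset.mul_sum]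
  refine Finset.sum_congr rfl fun i _ => ?_
  rw [Finset.mul_sum, Finset.mul_sum]
  refine Finset.sum_congr rfl fun i' _ => ?_
  by_cases hi : i < r ^ j
  swap
  · simp [hα i (not_lt.1 hi)]
  by_cases hi' : i' < r ^ j
  swap
  · simp [hβ i' (not_lt.1 hi')]
  split_ifs with hv'
  · have : i + i' + (N - v) = N := by omega
    rw [this, hω]
    simp
    ring
  · rw [one_sub_mul_sum_pow_eq_zero hr j hω]
    · simp
    -- The exponent lies strictly between `0` and `2 * N`; were it a multiple of `N`, it would be
    -- `N`, forcing `i + i' = v`.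
    · rintro ⟨k, hk⟩
      rw [← hN] at hk
      have hk0 : k ≠ 0 := by
        rintro rfl
        omega
      have hk2 : k < 2 := by
        by_contra h
        have : N * 2 ≤ N * k := Nat.mul_le_mul_left _ (not_lt.1 h)
        omega
      obtain rfl : k = 1 := by omega
      omega

/-! ### Cutting polynomials into blocks -/

section Blocks

variable {F : Type*} [Field F]

/-- The `u`-th block of `t` coefficients of `p`. -/
noncomputable def blockPoly (t : ℕ) (p : F[X]) (u : ℕ) : F[X] :=
  ∑ w ∈ Finset.range t, monomial w (p.coeff (u * t + w))

theorem coeff_blockPoly (t : ℕ) (p : F[X]) (u w : ℕ) :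
    (blockPoly t p u).coeff w = if w < t then p.coeff (u * t + w) else 0 := by
  simp only [blockPoly, finsetSum_coeff, coeff_monomial, Finset.sum_ite_eq', Finset.mem_range]

theorem degree_blockPoly_lt (t : ℕ) (p : F[X]) (u : ℕ) : (blockPoly t p u).degree < t := by
  rw [degree_lt_iff_coeff_zero]
  intro i hi
  rw [coeff_blockPoly, if_neg (by omega)]

theorem blockPoly_eq_zero {s t : ℕ} {p : F[X]} (hp : p.degree < (s * t : ℕ)) {u : ℕ} (hu : s ≤ u) :
    blockPoly t p u = 0 := by
  ext w
  rw [coeff_blockPoly, coeff_zero, ite_eq_right_iff]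
  intro _
  refine coeff_eq_zero_of_degree_lt (hp.trans_le (Nat.cast_le.2 ?_))
  exact (Nat.mul_le_mul_right t hu).trans (Nat.le_add_right _ _)

theorem sum_blockPoly {N t : ℕ} {p : F[X]} (hp : p.degree < (N * t : ℕ)) :
    p = ∑ u ∈ Finset.range N, X ^ (u * t) * blockPoly t p u := by
  have h : p = ∑ i ∈ Finset.range (N * t), monomial i (p.coeff i) := by
    ext j
    simp only [finsetSum_coeff, coeff_monomial, Finset.sum_ite_eq', Finset.mem_range]
    split_ifs with hj
    · rfl
    · exact coeff_eq_zero_of_degree_lt (hp.trans_le (by exact_mod_cast not_lt.1 hj))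
  conv_lhs => rw [h]
  rw [Finset.sum_range_mul_eq, Finset.sum_comm]
  refine Finset.sum_congr rfl fun u _ => ?_
  rw [blockPoly, Finset.mul_sum]
  refine Finset.sum_congr rfl fun w _ => ?_
  rw [← C_mul_X_pow_eq_monomial, ← C_mul_X_pow_eq_monomial, pow_add]
  ring

theorem degree_convSeq_lt {N t : ℕ} {α β : ℕ → F[X]} (hα : ∀ i, (α i).degree < t)
    (hβ : ∀ i, (β i).degree < t) (v : ℕ) : (convSeq N α β v).degree < (2 * t : ℕ) := by
  refine (degree_lt_iff_coeff_zero _ _).2 fun k hk => ?_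
  simp only [convSeq, finsetSum_coeff]
  refine Finset.sum_eq_zero fun i _ => Finset.sum_eq_zero fun i' _ => ?_
  split_ifs
  · refine coeff_eq_zero_of_degree_lt ((degree_mul_lt_add (hα i) (hβ i')).trans_le ?_)
    exact_mod_cast (by omega)
  · simp

/-- Both factors are polynomials in `X ^ t` with at most `s` nonzero blocks, so by `2 * s ≤ N` every
index of the product is below `N`. -/
theorem mul_eq_sum_convSeq {s N t : ℕ} (hN : 2 * s ≤ N) {p q : F[X]}
    (hp : p.degree < (s * t : ℕ)) (hq : q.degree < (s * t : ℕ)) :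
    p * q = ∑ v ∈ Finset.range N, X ^ (v * t) * convSeq N (blockPoly t p) (blockPoly t q) v := by
  have hle : ((s * t : ℕ) : WithBot ℕ) ≤ (N * t : ℕ) :=
    Nat.cast_le.2 (Nat.mul_le_mul_right t (by omega))
  conv_lhs => rw [sum_blockPoly (hp.trans_le hle), sum_blockPoly (hq.trans_le hle)]
  rw [Finset.sum_mul_sum]
  simp only [convSeq, Finset.mul_sum]
  symm
  rw [Finset.sum_comm]
  refine Finset.sum_congr rfl fun i _ => ?_
  rw [Finset.sum_comm]
  refine Finset.sum_congr rfl fun i' _ => ?_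
  by_cases hi : i < s
  swap
  · simp [blockPoly_eq_zero hp (not_lt.1 hi)]
  by_cases hi' : i' < s
  swap
  · simp [blockPoly_eq_zero hq (not_lt.1 hi')]
  simp only [mul_ite, mul_zero, Finset.sum_ite_eq, Finset.mem_range]
  rw [if_pos (by omega)]
  ring

end Blocks

/-- The shifted summands may overlap, but adding the next one alters only `d` coefficients; hence
the linear cost `N * d`. -/
theorem CoeffsIn.exists_shifted_sum {Ω F : Type*} [Field F] {S : Set (Ω → F)}
    (h0 : (fun _ => 0) ∈ S) {c : ℕ → Ω → F[X]} (t d N : ℕ) (hd : ∀ v < N, ∀ x, (c v x).degree < d)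
    (hc : ∀ v < N, CoeffsIn S (c v)) :
    ∃ U, Derives S (N * d) U ∧
      CoeffsIn U fun x => ∑ v ∈ Finset.range N, X ^ (v * t) * c v x := by
  induction N with
  | zero => exact ⟨S, by simpa using Derives.refl, fun i => by simpa using h0⟩
  | succ N ih =>
    obtain ⟨U, hU, hsum⟩ := ih (fun v hv => hd v (hv.trans N.lt_succ_self))
      fun v hv => hc v (hv.trans N.lt_succ_self)
    obtain ⟨V, hV, h⟩ := CoeffsIn.of_forall
      (a := fun x => ∑ v ∈ Finset.range (N + 1), X ^ (v * t) * c v x) (N * t) d 1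
      (fun i hi => by
        convert hsum i using 2 with x
        rw [Finset.sum_range_succ, coeff_add, coeff_X_pow_mul', add_eq_left]
        split_ifs with hle
        · exact coeff_eq_zero_of_degree_lt
            ((hd N N.lt_succ_self x).trans_le (by exact_mod_cast (by omega)))
        · rfl)
      fun i hi W hW => ⟨_, Derives.refl.op .add (hW (hsum (N * t + i)))
        (hW (hU.subset (hc N N.lt_succ_self i))), Or.inl <| by
          funext x
          simp [Finset.sum_range_succ, FieldOp.eval, add_comm (N * t), coeff_X_pow_mul]⟩
    exact ⟨V, (hU.trans hV).weaken (by rw [Nat.succ_mul]; omega), h⟩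

/-- From a representative of `E` with `(1 - x ^ M') * E = (1 - x ^ M') * (n * c)` modulo
`x ^ M - 1`, the polynomial `c` can be computed if its degree is small and `n ≠ 0`. -/
theorem ClassIn.exists_recover {Ω F : Type*} [Field F] {S : Set (Ω → F)} (h0 : (fun _ => 0) ∈ S)
    {M M' d n : ℕ} (hM' : 0 < M') (hM : 2 * M' ≤ M) (hd : d ≤ M') (hn : (n : F) ≠ 0)
    {E : Ω → CyclicRing F M}
    (hE : ClassIn S E) {c : Ω → F[X]} (hc : ∀ x, (c x).degree < d)
    (h : ∀ x, (1 - AdjoinRoot.root _ ^ M') * E x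
      = (1 - AdjoinRoot.root _ ^ M') * ((n : CyclicRing F M) * AdjoinRoot.mk _ (c x))) :
    ∃ U, Derives S (d * 2) U ∧ CoeffsIn U c := by
  obtain ⟨e, he, hdeg, hmk⟩ := hE
  refine CoeffsIn.of_forall_lt h0 d 2 hc fun w hw U hU => ?_
  -- Compare the coefficients at `w < d ≤ M'`. Multiplying `e` by `1 - x ^ M'` cyclically gives `e_w
  -- - e_(w + M - M')`. On the other side only `n * c_w` remains, since `w + M - M' ≥ M' ≥ d`. This
  -- costs one subtraction and one division.
  have hcoeff : ∀ x, (c x).coeff w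
      = ((e x).coeff w - (e x).coeff (w + M - M')) / n := fun x => by
    have hlt : ∀ {p : F[X]} {k : ℕ}, p.degree < k → k ≤ M → ((1 - X ^ M') * p).degree
        < ((2 * M : ℕ) : WithBot ℕ) := fun {p k} hp hk => by
      have h1 : (1 - X ^ M' : F[X]).degree < (M' + 1 : ℕ) := by
        refine (degree_lt_iff_coeff_zero _ _).2 fun i hi => ?_
        rw [coeff_sub, coeff_one, coeff_X_pow, if_neg (by omega), if_neg (by omega), sub_zero]
      exact (degree_mul_lt_add h1 hp).trans_le (Nat.cast_le.2 (by omega))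
    have key := coeff_add_coeff_eq (M := M) (p := (1 - X ^ M') * e x)
      (q := (1 - X ^ M') * (C (n : F) * c x)) (hlt (hdeg x) le_rfl)
      (hlt (k := d) ((degree_C_mul hn).trans_lt (hc x)) (by omega)) ?_ (w := w) (by omega)
    · have z1 : (e x).coeff (w + M) = 0 :=
        coeff_eq_zero_of_degree_lt ((hdeg x).trans_le (by exact_mod_cast (by omega)))
      have z2 : (c x).coeff (w + M) = 0 :=
        coeff_eq_zero_of_degree_lt ((hc x).trans_le (by exact_mod_cast (by omega)))
      have z3 : (c x).coeff (w + M - M') = 0 :=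
        coeff_eq_zero_of_degree_lt ((hc x).trans_le (by exact_mod_cast (by omega)))
      simp only [sub_mul, one_mul, coeff_sub, coeff_X_pow_mul', coeff_C_mul, z1, z2, z3,
        if_neg (show ¬ M' ≤ w by omega), if_pos (show M' ≤ w + M by omega)] at key
      rw [eq_div_iff hn]
      linear_combination -key
    · rw [map_mul, map_mul, hmk, map_sub, map_pow, map_one, AdjoinRoot.mk_X, h, map_mul,
        AdjoinRoot.mk_C, map_natCast]
  have h1 := (Derives.refl (S := U)).const (n : F)
  have h2 := h1.op .sub (Or.inr (hU (he w))) (Or.inr (hU (he (w + M - M'))))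
  have h3 := h2.op .div (Set.mem_insert _ _) (Or.inr (Set.mem_insert _ _))
  exact ⟨_, h3, Or.inl (funext fun x => by simp [FieldOp.eval, hcoeff x])⟩

theorem coeffsIn_blockPoly {Ω F : Type*} [Field F] {S : Set (Ω → F)} (h0 : (fun _ => 0) ∈ S)
    {a : Ω → F[X]} (ha : CoeffsIn S a) (t u : ℕ) : CoeffsIn S fun x => blockPoly t (a x) u := by
  intro i
  simp only [coeff_blockPoly]
  split_ifs
  · exact ha _
  · exact h0

/-- The recursive step of the algorithm of Schönhage and Strassen in radix `r`. -/
theorem MulBound.step {F : Type u} [Field F] {r : ℕ} (hr : r.Prime) (hrF : (r : F) ≠ 0)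
    {a b c : ℕ} (hab : b ≤ a + 1) (hc : MulBound F (r ^ (a + 2)) c) :
    MulBound F (r ^ (a + b))
      (r ^ (b + 1) * (c + r ^ (a + 2) * (3 * ((b + 1) * r) + 4))) := by
  intro Ω S p q h0 hp hq hSp hSq
  have h2 : ∀ k, 2 * r ^ k ≤ r ^ (k + 1) := fun k => by
    rw [pow_succ, mul_comm]
    exact Nat.mul_le_mul_left _ hr.two_le
  have hpos : ∀ k, 0 < r ^ k := fun k => pow_pos hr.pos k
  -- There are `r ^ b` blocks of length `t`, and the transform has length `N = r * r ^ b`, at least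
  -- twice the number of blocks. With `M = r ^ (a + 2)`, products of blocks have degree less than `2
  -- * t ≤ M / r`, as `ClassIn.exists_recover` demands.
  set t := r ^ a with ht
  set N := r ^ (b + 1) with hN
  set M := r ^ (a + 2) with hM
  have hM0 : 0 < M := hpos _
  have hM' : 2 * r ^ (a + 1) ≤ M := h2 (a + 1)
  have htM : 2 * t ≤ r ^ (a + 1) := h2 a
  have hst : r ^ (a + b) = r ^ b * t := by rw [pow_add, mul_comm]
  rw [hst] at hp hq
  set ξ := AdjoinRoot.root (X ^ M - 1 : F[X])
  -- The exponent is `M / N`, an integer because `b ≤ a + 1`.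
  set ω := ξ ^ r ^ (a + 1 - b) with hω
  have hω1 : ω ^ r ^ (b + 1) = 1 := by
    rw [hω, ← pow_mul, ← pow_add, show a + 1 - b + (b + 1) = a + 2 by omega]
    exact root_pow_eq_one M
  -- Thus the unavoidable factor `1 - ω ^ (N / r)` is `1 - x ^ (M / r)`, whose effect can be undone
  -- on polynomials of small degree.
  have hω2 : ω ^ r ^ b = ξ ^ r ^ (a + 1) := by
    rw [hω, ← pow_mul, ← pow_add, show a + 1 - b + b = a + 1 by omega]
  have hblock : ∀ {f : Ω → F[X]}, CoeffsIn S f → ∀ u,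
      ClassIn S fun x => AdjoinRoot.mk (X ^ M - 1) (blockPoly t (f x) u) := fun hf u =>
    ⟨_, coeffsIn_blockPoly h0 hf t u, fun x => (degree_blockPoly_lt _ _ _).trans_le
      (Nat.cast_le.2 (by omega)), fun x => rfl⟩
  obtain ⟨U₁, hU₁, hA⟩ := ClassIn.exists_dft hM0 hr.pos (b + 1) _ hω1 S h0 _
    fun u _ => hblock hSp u
  obtain ⟨U₂, hU₂, hB⟩ := ClassIn.exists_dft hM0 hr.pos (b + 1) _ hω1 U₁ (hU₁.subset h0) _
    fun u _ => (hblock hSq u).mono hU₁.subset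
  obtain ⟨U₃, hU₃, hC⟩ := Derives.forall_lt
    (fun i U V hUV (h : ClassIn U fun x =>
      (∑ u ∈ Finset.range N, AdjoinRoot.mk (X ^ M - 1) (blockPoly t (p x) u) * ω ^ (i * u)) *
      ∑ u ∈ Finset.range N, AdjoinRoot.mk (X ^ M - 1) (blockPoly t (q x) u) * ω ^ (i * u)) =>
        h.mono hUV) N U₂ fun i _ U hU => ClassIn.exists_mul hc
      (hU (hU₂.subset (hU₁.subset h0))) ((hA i).mono (hU₂.subset.trans hU)) ((hB i).mono hU)
  have h0₃ := hU₃.subset (hU₂.subset (hU₁.subset h0))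
  obtain ⟨U₄, hU₄, hE⟩ := ClassIn.exists_dft hM0 hr.pos (b + 1) _ hω1 U₃ h0₃ _ hC
  obtain ⟨U₅, hU₅, hcv⟩ := Derives.forall_lt
    (fun v U V hUV (h : CoeffsIn U fun x =>
      convSeq N (blockPoly t (p x)) (blockPoly t (q x)) v) => h.mono hUV) N U₄
    fun v hv U hU => ClassIn.exists_recover (hU (hU₄.subset h0₃)) (M := M) (M' := r ^ (a + 1))
      (n := N) (hpos _) hM' htM (by rw [hN, Nat.cast_pow]; exact pow_ne_zero _ hrF)
      ((hE (N - v)).mono hU) (fun x => degree_convSeq_lt (degree_blockPoly_lt t _)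
        (degree_blockPoly_lt t _) v) fun x => by
        rw [← hω2]
        refine (inverse_dft_mul hr b hω1 (fun i hi => ?_) (fun i hi => ?_) hv).trans ?_
        · rw [blockPoly_eq_zero (hp x) hi, map_zero]
        · rw [blockPoly_eq_zero (hq x) hi, map_zero]
        · simp only [convSeq, map_sum, apply_ite (AdjoinRoot.mk (X ^ M - 1 : F[X])), map_mul,
            map_zero, hN]
  obtain ⟨U₆, hU₆, hout⟩ := CoeffsIn.exists_shifted_sum (hU₅.subset (hU₄.subset h0₃)) t (2 * t) N
    (fun v _ x => degree_convSeq_lt (degree_blockPoly_lt t _) (degree_blockPoly_lt t _) v) hcv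
  refine ⟨U₆, (((((hU₁.trans hU₂).trans hU₃).trans hU₄).trans hU₅).trans hU₆).weaken ?_, ?_⟩
  · have h1 : N * (2 * t * 2) + N * (2 * t) ≤ N * (3 * M) := by
      rw [← mul_add]
      exact Nat.mul_le_mul_left _ (by omega)
    calc _ = N * c + 3 * ((b + 1) * N * (M * r)) + N * M
          + (N * (2 * t * 2) + N * (2 * t)) := by ring
      _ ≤ N * c + 3 * ((b + 1) * N * (M * r)) + N * M + N * (3 * M) := by omega
      _ = _ := by ring
  · convert hout using 2 with x
    exact mul_eq_sum_convSeq (h2 b) (hp x) (hq x)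

/-- Polynomials of degree less than `r ^ k` can be multiplied with `O (r ^ k * k ^ 10)` operations,
if `r ≤ 3` is a prime number that does not vanish in the field. -/
theorem exists_mulBound_pow : ∃ A : ℕ, ∀ (F : Type u) [Field F] (r : ℕ), r.Prime → r ≤ 3 →
    (r : F) ≠ 0 → ∀ k, MulBound F (r ^ k) (r ^ k * (A * (k + 1) ^ 10)) := by
  -- The first summand covers the school method for `k < 16`, the second the overhead of the
  -- recursive step.
  refine ⟨8 * 3 ^ 15 + 27 * 2 * 50, fun F _ r hr hr3 hrF k => ?_⟩
  generalize hA : 8 * 3 ^ 15 + 27 * 2 * 50 = A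
  induction k using Nat.strong_induction_on with
  | _ k ih =>
  rcases Nat.lt_or_ge k 16 with hk | hk
  · refine (mulBound_naive F (r ^ k)).mono le_rfl ?_
    have h1 : r ^ k ≤ 3 ^ 15 := (Nat.pow_le_pow_left hr3 k).trans
      (Nat.pow_le_pow_right (by norm_num) (by omega))
    have h2 : 1 ≤ (k + 1) ^ 10 := Nat.one_le_pow _ _ (by omega)
    calc 2 * r ^ k * (2 * (2 * r ^ k)) = r ^ k * (8 * r ^ k) := by ring
      _ ≤ r ^ k * (A * (k + 1) ^ 10) := by
        refine Nat.mul_le_mul_left _ ?_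
        calc 8 * r ^ k ≤ A * 1 := by omega
          _ ≤ _ := Nat.mul_le_mul_left _ h2
  -- Halving `k` balances block length and number of blocks; the recursion passes from `k` to about
  -- `k / 2 + 2`.
  · obtain ⟨a, b, rfl, hb, ha⟩ : ∃ a b, k = a + b ∧ b ≤ a ∧ a ≤ b + 1 :=
      ⟨k - k / 2, k / 2, by omega, by omega, by omega⟩
    have h := MulBound.step hr hrF (show b ≤ a + 1 by omega) (ih (a + 2) (by omega))
    refine h.mono le_rfl ?_
    set x := a + b + 1 with hx
    -- The step loses a factor `r ^ 3 ≤ 27`. As `(3 / 2) ^ 10 > 54 = 2 * 27`, the tenth power leaves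
    -- the recursive term at most half of `A * x ^ 10`; the other half pays for the overhead.
    have h3 : 54 * (a + 2 + 1) ^ 10 ≤ x ^ 10 := by
      have : 3 * (a + 2 + 1) ≤ 2 * x := by omega
      have h10 := Nat.pow_le_pow_left this 10
      rw [mul_pow, mul_pow] at h10
      have e1 : 3 ^ 10 = 59049 := by norm_num
      have e2 : 2 ^ 10 = 1024 := by norm_num
      rw [e1, e2] at h10
      omega
    have h4 : 3 * ((b + 1) * r) + 4 ≤ 50 * x ^ 10 := by
      have h5 : x ≤ x ^ 10 := Nat.le_self_pow (by norm_num) x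
      have h6 : (b + 1) * r ≤ x * 3 := Nat.mul_le_mul (by omega) hr3
      omega
    have h27 : r ^ 3 ≤ 27 := (Nat.pow_le_pow_left hr3 3).trans (by norm_num)
    calc r ^ (b + 1) * (r ^ (a + 2) * (A * (a + 2 + 1) ^ 10)
          + r ^ (a + 2) * (3 * ((b + 1) * r) + 4))
        = r ^ (a + b) * (r ^ 3 * (A * (a + 2 + 1) ^ 10 + (3 * ((b + 1) * r) + 4))) := by ring
      _ ≤ r ^ (a + b) * (27 * (A * (a + 2 + 1) ^ 10 + 50 * x ^ 10)) := by gcongr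
      _ ≤ r ^ (a + b) * (A * x ^ 10) := by
        refine Nat.mul_le_mul_left _ ?_
        have h7 : A * (54 * (a + 2 + 1) ^ 10) ≤ A * x ^ 10 := Nat.mul_le_mul_left _ h3
        have h8 : (27 * 2 * 50) * x ^ 10 ≤ A * x ^ 10 := Nat.mul_le_mul_right _ (by omega)
        nlinarith

/-- Quasi-linear multiplication of polynomials over an arbitrary field. -/
theorem exists_mulCost_le : ∃ A : ℕ, ∀ (F : Type u) [Field F] (n : ℕ), 0 < n →
    mulCost F n ≤ A * n * (Nat.log 2 n + 2) ^ 10 := by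
  obtain ⟨A, hA⟩ := exists_mulBound_pow.{u}
  refine ⟨3 * A, fun F _ n hn => ?_⟩
  -- The numbers 2 and 3 differ by 1, so they cannot both vanish in `F`.
  obtain ⟨r, hr, hr3, hrF⟩ : ∃ r : ℕ, r.Prime ∧ r ≤ 3 ∧ (r : F) ≠ 0 := by
    by_cases h2 : (2 : F) = 0
    · refine ⟨3, Nat.prime_three, le_rfl, ?_⟩
      rw [show ((3 : ℕ) : F) = 2 + 1 by norm_num, h2, zero_add]
      exact one_ne_zero
    · exact ⟨2, Nat.prime_two, by norm_num, by simpa using h2⟩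
  have h1 : n < r ^ (Nat.log r n + 1) := Nat.lt_pow_succ_log_self hr.one_lt n
  refine mulCost_le ((hA F r hr hr3 hrF (Nat.log r n + 1)).mono h1.le ?_)
  have h2 : r ^ (Nat.log r n + 1) ≤ 3 * n := by
    rw [pow_succ, mul_comm]
    exact Nat.mul_le_mul hr3 (Nat.pow_log_le_self r hn.ne')
  have h3 : Nat.log r n ≤ Nat.log 2 n := Nat.log_anti_left (by norm_num) hr.two_le
  calc r ^ (Nat.log r n + 1) * (A * (Nat.log r n + 1 + 1) ^ 10)
      ≤ 3 * n * (A * (Nat.log 2 n + 2) ^ 10) := by gcongr ?_ * (A * ?_ ^ 10); omega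
    _ = _ := by ring

/-! ### Reduction modulo `X ^ m - 1` -/

/-- As `X ^ m ≡ 1`, each term moves to its exponent modulo `m`; terms merge exactly when their
exponents are congruent. -/
theorem modByMonic_X_pow_sub_one_coeff {F : Type*} [Field F] (f : F[X]) {m : ℕ} (hm : 0 < m)
    {i : ℕ} :
    (f %ₘ (X ^ m - 1)).coeff i = ∑ e ∈ f.support with e % m = i, f.coeff e := by
  have hmonic : (X ^ m - 1 : F[X]).Monic := by simpa using monic_X_pow_sub_C (1 : F) hm.ne'
  have hdeg : (X ^ m - 1 : F[X]).degree = m := by simpa using degree_X_pow_sub_C hm (1 : F)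
  have h : f %ₘ (X ^ m - 1) = ∑ e ∈ f.support, monomial (e % m) (f.coeff e) := by
    refine eq_of_mk_eq_mk hm (hdeg ▸ degree_modByMonic_lt f hmonic) ?_ ?_
    · refine (degree_lt_iff_coeff_zero _ _).2 fun k hk => ?_
      rw [finsetSum_coeff]
      refine Finset.sum_eq_zero fun e _ => ?_
      rw [coeff_monomial, if_neg]
      have := Nat.mod_lt e hm
      omega
    · rw [AdjoinRoot.mk_eq_mk.2 (by
        rw [modByMonic_eq_sub_mul_div]; exact ⟨-(f /ₘ (X ^ m - 1)), by ring⟩ :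
        (X ^ m - 1 : F[X]) ∣ f %ₘ (X ^ m - 1) - f)]
      conv_lhs => rw [f.as_sum_support]
      rw [map_sum, map_sum]
      refine Finset.sum_congr rfl fun e _ => ?_
      have hpow : (AdjoinRoot.root (X ^ m - 1 : F[X])) ^ e = AdjoinRoot.root _ ^ (e % m) := by
        conv_lhs => rw [← Nat.mod_add_div e m, pow_add, pow_mul, root_pow_eq_one, one_pow, mul_one]
      rw [← C_mul_X_pow_eq_monomial, ← C_mul_X_pow_eq_monomial, map_mul, map_mul, map_pow, map_pow,
        AdjoinRoot.mk_X, hpow]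
  rw [h, finsetSum_coeff, Finset.sum_filter]
  simp only [coeff_monomial]

theorem squarefree_X_pow_sub_one {F : Type*} [Field F] {m : ℕ} (hm : (m : F) ≠ 0) :
    Squarefree (X ^ m - 1 : F[X]) := by
  have := (separable_X_pow_sub_C (1 : F) hm one_ne_zero).squarefree
  simpa using this

/-! ### Prime numbers that do not divide the size of the field -/

/-- `m` is a prime number that does not divide `q`. -/
def GoodPrime (q m : ℕ) : Prop := m.Prime ∧ ¬ m ∣ q

/-- Each of two proper factors of `m` divides `(m - 1)!`. The square avoids a separate treatment of
equal factors, in particular of `m = 4`. -/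
theorem dvd_factorial_sq {m : ℕ} (hm : 2 ≤ m) (h : ¬ m.Prime) :
    m ∣ (m - 1).factorial * (m - 1).factorial := by
  obtain ⟨a, b, ha, hb, rfl⟩ := (Nat.not_prime_iff_exists_mul_eq hm).1 h
  have hb0 : 0 < b := Nat.pos_of_ne_zero fun h => by subst h; omega
  have ha0 : 0 < a := Nat.pos_of_ne_zero fun h => by subst h; omega
  exact mul_dvd_mul (Nat.dvd_factorial ha0 (by omega)) (Nat.dvd_factorial hb0 (by omega))

/-- A test in the style of Wilson's theorem, by one remainder and a running factorial; it is free
for the program. -/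
theorem goodPrime_iff {q m : ℕ} (hm : 2 ≤ m) :
    GoodPrime q m ↔ (m - 1).factorial * (m - 1).factorial * q % m ≠ 0 := by
  rw [Ne, ← Nat.dvd_iff_mod_eq_zero, GoodPrime]
  by_cases hp : m.Prime
  · rw [hp.dvd_mul, hp.dvd_mul, hp.dvd_factorial]
    simp only [hp, true_and, or_self]
    have : ¬ m ≤ m - 1 := by omega
    tauto
  · simp only [hp, false_and, false_iff, not_not]
    exact (dvd_factorial_sq hm hp).mul_right q

theorem GoodPrime.cast_ne_zero {F : Type*} [Field F] [Fintype F] {m : ℕ}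
    (h : GoodPrime (Fintype.card F) m) : (m : F) ≠ 0 := by
  intro h0
  obtain ⟨p, hp⟩ := CharP.exists F
  obtain ⟨n, hprime, hn⟩ := FiniteField.card F p
  have := (Nat.prime_dvd_prime_iff_eq hprime h.1).1 ((CharP.cast_eq_zero_iff F p m).1 h0)
  subst this
  exact h.2 (hn ▸ dvd_pow_self p n.ne_zero)

open Classical in
/-- The good primes up to `m`. -/
noncomputable def goodPrimes (q m : ℕ) : Finset ℕ := (Finset.range (m + 1)).filter (GoodPrime q)

theorem mem_goodPrimes {q m p : ℕ} : p ∈ goodPrimes q m ↔ p ≤ m ∧ GoodPrime q p := by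
  simp [goodPrimes]

theorem goodPrimes_one (q : ℕ) : goodPrimes q 1 = ∅ := by
  ext p
  simp only [mem_goodPrimes, Finset.notMem_empty, iff_false, not_and]
  exact fun h hp => by have := hp.1.two_le; omega

open Classical in
theorem card_goodPrimes_succ (q m : ℕ) : (goodPrimes q (m + 1)).card
    = (goodPrimes q m).card + if GoodPrime q (m + 1) then 1 else 0 := by
  rw [goodPrimes, Finset.range_add_one, Finset.filter_insert]
  split_ifs
  · rw [Finset.card_insert_of_notMem (by simp), goodPrimes]
  · rfl

theorem goodPrimes_mono (q : ℕ) {m n : ℕ} (h : m ≤ n) : goodPrimes q m ⊆ goodPrimes q n := by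
  intro p
  simp only [mem_goodPrimes]
  exact fun hp => ⟨hp.1.trans h, hp.2⟩

/-- Since `q` is a power of the characteristic, only one prime is excluded. -/
theorem primeCounting_le_card_goodPrimes (F : Type*) [Field F] [Fintype F] (m : ℕ) :
    Nat.primeCounting m ≤ (goodPrimes (Fintype.card F) m).card + 1 := by
  obtain ⟨p, hp⟩ := CharP.exists F
  obtain ⟨n, hprime, hn⟩ := FiniteField.card F p
  rw [Nat.primeCounting, Nat.primeCounting', Nat.count_eq_card_filter_range]
  refine (Finset.card_le_card fun r hr => ?_).trans (Finset.card_insert_le p _)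
  rw [Finset.mem_filter, Finset.mem_range] at hr
  by_cases hrp : r = p
  · exact Finset.mem_insert.2 (Or.inl hrp)
  · refine Finset.mem_insert.2 (Or.inr (mem_goodPrimes.2 ⟨by omega, hr.2, fun hd => hrp ?_⟩))
    rw [hn] at hd
    exact (Nat.prime_dvd_prime_iff_eq hr.2 hprime).1 (hr.2.dvd_of_dvd_pow hd)

/-- There are at least `N + 1` primes up to `16 * (N + 2) * (log N + 1)`. -/
theorem exists_lt_primeCounting (N : ℕ) :
    ∃ M, M ≤ 16 * (N + 2) * (Nat.log 2 (N + 2) + 1) ∧ N < Nat.primeCounting M := by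
  -- `L` and `L'` are the binary lengths of `N + 2` and `4 * L`, so `M = 2 ^ (L + L')` exceeds `(L +
  -- L') * (N + 2)`.
  set L := Nat.log 2 (N + 2) + 1 with hL
  set L' := Nat.log 2 (4 * L) + 1 with hL'
  have h1 : N + 2 < 2 ^ L := Nat.lt_pow_succ_log_self (by norm_num) _
  have h2 : 4 * L < 2 ^ L' := Nat.lt_pow_succ_log_self (by norm_num) _
  have h3 : 2 ^ L ≤ 2 * (N + 2) := by
    rw [hL, pow_succ, mul_comm]
    exact Nat.mul_le_mul_left _ (Nat.pow_log_le_self 2 (by omega))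
  have h4 : 2 ^ L' ≤ 2 * (4 * L) := by
    rw [hL', pow_succ, mul_comm]
    exact Nat.mul_le_mul_left _ (Nat.pow_log_le_self 2 (by omega))
  have hL0 : 1 ≤ L := by omega
  have h5 : L' ≤ 3 * L := by
    have : Nat.log 2 (4 * L) < 3 * L := Nat.log_lt_of_lt_pow (by omega) (by
      calc 4 * L < 4 * 2 ^ L := by have := Nat.lt_two_pow_self (n := L); omega
        _ = 2 ^ (L + 2) := by ring
        _ ≤ 2 ^ (3 * L) := Nat.pow_le_pow_right (by norm_num) (by omega))
    omega
  set k := L + L' with hk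
  refine ⟨2 ^ k, ?_, ?_⟩
  · calc 2 ^ k = 2 ^ L * 2 ^ L' := pow_add _ _ _
      _ ≤ 2 * (N + 2) * (2 * (4 * L)) := Nat.mul_le_mul h3 h4
      _ = _ := by ring
  · by_contra hle
    have hpow : k * (N + 2) < 2 ^ k := by
      calc k * (N + 2) ≤ 2 ^ L' * (N + 2) := Nat.mul_le_mul_right _ (by omega)
        _ < 2 ^ L' * 2 ^ L := Nat.mul_lt_mul_of_pos_left h1 (by positivity)
        _ = 2 ^ k := by rw [hk]; ring
    -- Chebyshev's argument: `lcm(1, …, M) ≤ M ^ π(M)`, as each prime power in it is at most `M`,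
    -- while `2 ^ M ≤ (M + 1) * lcm(1, …, M)`. With `M = 2 ^ k` and `π(M) ≤ N` this would give `M <
    -- k * (N + 1) + 1`.
    have hlcm : Nat.lcmUpto (2 ^ k) ≤ (2 ^ k) ^ Nat.primeCounting (2 ^ k) := by
      rw [Nat.lcmUpto_eq_prod_pow_log, ← Nat.primesLE_card_eq_primeCounting]
      exact Finset.prod_le_pow_card _ _ _ fun p _ => Nat.pow_log_le_self p (by positivity)
    have h6 : 2 ^ 2 ^ k < 2 ^ (k + 1 + k * N) := by
      calc 2 ^ 2 ^ k ≤ (2 ^ k + 1) * Nat.lcmUpto (2 ^ k) := Chebyshev.two_pow_le_mul_lcmUpto _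
        _ ≤ (2 ^ k + 1) * (2 ^ k) ^ N := by
          refine Nat.mul_le_mul_left _ (hlcm.trans ?_)
          exact Nat.pow_le_pow_right (by positivity) (not_lt.1 hle)
        _ < (2 ^ k * 2) * (2 ^ k) ^ N := by
          refine Nat.mul_lt_mul_of_pos_right ?_ (by positivity)
          have : 1 < 2 ^ k := Nat.one_lt_two_pow (by omega)
          omega
        _ = _ := by rw [← pow_mul, ← pow_succ, ← pow_add]
    have h7 := (Nat.pow_lt_pow_iff_right (by norm_num : 1 < 2)).1 h6
    have h8 : k * (N + 2) = k * N + 2 * k := by ring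
    omega

/-! ### Recovering the terms of a sparse polynomial -/

theorem card_le_of_forall_dvd {S : Finset ℕ} (hS : ∀ p ∈ S, p.Prime) {d B : ℕ} (hd : d ≠ 0)
    (hB : d < 2 ^ B) (h : ∀ p ∈ S, p ∣ d) : S.card ≤ B := by
  have h1 : ∏ p ∈ S, p ≤ d := Nat.le_of_dvd (Nat.pos_of_ne_zero hd)
    (Finset.prod_primes_dvd d (fun p hp => (hS p hp).prime) h)
  have h2 : 2 ^ S.card ≤ ∏ p ∈ S, p := Finset.pow_card_le_prod _ _ _ fun p hp => (hS p hp).two_le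
  exact ((Nat.pow_lt_pow_iff_right (by norm_num)).1 (h2.trans_lt (h1.trans_lt hB))).le

/-! ### Collisions of exponents and the majority vote -/

section Votes

variable {F : Type*} [Field F]

/-- No exponent of `f` other than `e` is congruent to `e` modulo `m`. -/
def Isolated (f : F[X]) (e m : ℕ) : Prop := ∀ e' ∈ f.support, e' ≠ e → e' % m ≠ e % m

theorem Isolated.coeff_modByMonic {f : F[X]} {e m : ℕ} (h : Isolated f e m) (hm : 0 < m) :
    (f %ₘ (X ^ m - 1)).coeff (e % m) = f.coeff e := by
  rw [modByMonic_X_pow_sub_one_coeff f hm, Finset.sum_filter]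
  rw [Finset.sum_eq_single e]
  · simp
  · intro e' he' hne
    rw [if_neg (h e' he' hne)]
  · intro he
    simpa using he

open Classical in
-- Each bad prime divides the distance from `e` to another exponent of `f`. There are at most `T`
-- such distances, all nonzero and below `2 ^ B`, with at most `B` prime divisors each.
theorem card_not_isolated_le {f : F[X]} {T B : ℕ} (hT : f.support.card ≤ T)
    (hB : ∀ e ∈ f.support, e < 2 ^ B) {e : ℕ} (he : e < 2 ^ B) (q M : ℕ) :
    ((goodPrimes q M).filter fun m => ¬ Isolated f e m).card ≤ T * B := by
  have hsub : ((goodPrimes q M).filter fun m => ¬ Isolated f e m) ⊆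
      f.support.biUnion fun e' => (goodPrimes q M).filter fun m => e' ≠ e ∧ e' % m = e % m := by
    intro m hm
    simp only [Finset.mem_filter, Isolated, not_forall, not_not] at hm
    obtain ⟨hm, e', he', hne, hmod⟩ := hm
    exact Finset.mem_biUnion.2 ⟨e', he', Finset.mem_filter.2 ⟨hm, hne, hmod⟩⟩
  refine (Finset.card_le_card hsub).trans ((Finset.card_biUnion_le_card_mul _ _ B
    fun e' he' => ?_).trans (Nat.mul_le_mul_right _ hT))
  by_cases hne : e' = e
  · simp [hne]
  -- This is the absolute difference, written with truncated subtraction.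
  · refine card_le_of_forall_dvd (d := (e' - e) + (e - e')) (fun p hp => ?_) (by omega) ?_
      fun p hp => ?_
    · exact (mem_goodPrimes.1 (Finset.mem_filter.1 hp).1).2.1
    · have := hB e' he'
      omega
    · have hmod : e' ≡ e [MOD p] := (Finset.mem_filter.1 hp).2.2
      rcases le_total e e' with hle | hle
      · rw [Nat.sub_eq_zero_of_le hle, add_zero]
        exact (Nat.modEq_iff_dvd' hle).1 hmod.symm
      · rw [Nat.sub_eq_zero_of_le hle, zero_add]
        exact (Nat.modEq_iff_dvd' hle).1 hmod

open Classical in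
/-- An exponent belongs to `f` if and only if the majority of the primes vote for it. -/
theorem lt_votes_iff {f : F[X]} {T B q M : ℕ} (hT : f.support.card ≤ T)
    (hB : ∀ e ∈ f.support, e < 2 ^ B) (hM : (goodPrimes q M).card = 2 * (T * B) + 1) {e : ℕ}
    (he : e < 2 ^ B) :
    T * B < ((goodPrimes q M).filter fun m => (f %ₘ (X ^ m - 1)).coeff (e % m) ≠ 0).card
      ↔ f.coeff e ≠ 0 := by
  -- At most `T * B` of the `2 * (T * B) + 1` votes can be wrong.
  have hbad := card_not_isolated_le hT hB he q M
  have hcoeff : ∀ m ∈ goodPrimes q M, Isolated f e m →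
      (f %ₘ (X ^ m - 1)).coeff (e % m) = f.coeff e := fun m hm h =>
    h.coeff_modByMonic (mem_goodPrimes.1 hm).2.1.pos
  constructor
  · intro hlt hzero
    refine absurd (hbad.trans_lt hlt) (not_lt.2 (Finset.card_le_card fun m hm => ?_))
    rw [Finset.mem_filter] at hm ⊢
    exact ⟨hm.1, fun h => hm.2 ((hcoeff m hm.1 h).trans hzero)⟩
  · intro hne
    have h1 := Finset.card_filter_add_card_filter_not (s := goodPrimes q M) fun m => Isolated f e m
    have h2 : ((goodPrimes q M).filter fun m => Isolated f e m).card ≤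
        ((goodPrimes q M).filter fun m => (f %ₘ (X ^ m - 1)).coeff (e % m) ≠ 0).card := by
      refine Finset.card_le_card fun m hm => ?_
      rw [Finset.mem_filter] at hm ⊢
      exact ⟨hm.1, (hcoeff m hm.1 hm.2).trans_ne hne⟩
    omega

theorem exists_isolated {f : F[X]} {T B q M : ℕ} (hT : f.support.card ≤ T)
    (hB : ∀ e ∈ f.support, e < 2 ^ B) (hM : (goodPrimes q M).card = 2 * (T * B) + 1) {e : ℕ}
    (he : e < 2 ^ B) : ∃ m ∈ goodPrimes q M, Isolated f e m := by
  classical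
  by_contra! h
  have hbad := card_not_isolated_le hT hB he q M
  rw [Finset.filter_true_of_mem h] at hbad
  omega

end Votes

/-! ### Deterministic programs -/

section Semantics

variable {F : Type*} [Field F] [Fintype F] {f : F[X]} {ℓ : ℕ} (box : RemainderBlackBox f ℓ)

/-- The program `p` is deterministic when started in `s`, and halts in the state `s'`. -/
def Runs (p : Program) (s s' : State F) : Prop :=
  ∃ n₀, ∀ n, p.exec box n s = PMF.pure (if n₀ ≤ n then some s' else none)

/-- The program `p` is deterministic when started in `s`, and halts in a state satisfying `Q`. -/
def Ensures (p : Program) (Q : State F → Prop) (s : State F) : Prop :=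
  ∃ s', Runs box p s s' ∧ Q s'

variable {box}

theorem Ensures.mono {p : Program} {Q Q' : State F → Prop} {s : State F} (h : Ensures box p Q s)
    (hQ : ∀ s', Q s' → Q' s') : Ensures box p Q' s := by
  obtain ⟨s', h, hs⟩ := h
  exact ⟨s', h, hQ s' hs⟩

theorem Ensures.skip {Q : State F → Prop} {s : State F} (h : Q s) : Ensures box .skip Q s :=
  ⟨s, ⟨0, fun _ => by simp [Program.exec]⟩, h⟩

theorem Ensures.seq {p p' : Program} {Q : State F → Prop} {s : State F}
    (h : Ensures box p (Ensures box p' Q) s) : Ensures box (.seq p p') Q s := by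
  obtain ⟨s₁, ⟨n₁, h₁⟩, s₂, ⟨n₂, h₂⟩, hQ⟩ := h
  refine ⟨s₂, ⟨max n₁ n₂, fun n => ?_⟩, hQ⟩
  simp only [Program.exec]
  rw [h₁, PMF.pure_bind]
  by_cases h : n₁ ≤ n
  · simp [h, h₂]
  · simp [h]

theorem Ensures.ite {e : NatExp} {p p' : Program} {Q : State F → Prop} {s : State F}
    (h : e.eval s.nat ≠ 0 → Ensures box p Q s) (h' : e.eval s.nat = 0 → Ensures box p' Q s) :
    Ensures box (.ite e p p') Q s := by
  by_cases he : e.eval s.nat = 0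
  · obtain ⟨s', ⟨n, hr⟩, hQ⟩ := h' he
    exact ⟨s', ⟨n, fun n => by
      simp only [Program.exec]
      rw [if_neg (not_not.2 he), hr]⟩, hQ⟩
  · obtain ⟨s', ⟨n, hr⟩, hQ⟩ := h he
    exact ⟨s', ⟨n, fun n => by
      simp only [Program.exec]
      rw [if_pos he, hr]⟩, hQ⟩

theorem Ensures.assign {a : ℕ} {i e : NatExp} {Q : State F → Prop} {s : State F}
    (h : Q (s.setNat a (i.eval s.nat) (e.eval s.nat) 0)) : Ensures box (.assign a i e) Q s :=
  ⟨_, ⟨0, fun _ => by simp [Program.exec]⟩, h⟩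

theorem Ensures.fieldOne {a : ℕ} {i : NatExp} {Q : State F → Prop} {s : State F}
    (h : Q (s.setFld a (i.eval s.nat) 1)) : Ensures box (.fieldOne a i) Q s :=
  ⟨_, ⟨0, fun _ => by simp [Program.exec]⟩, h⟩

theorem Ensures.fieldOp {o : FieldOp} {a b c : ℕ} {i j k : NatExp} {Q : State F → Prop}
    {s : State F} (h : Q (s.setFld a (i.eval s.nat)
        (o.eval (s.fld b (j.eval s.nat)) (s.fld c (k.eval s.nat))))) :
    Ensures box (.fieldOp o a i b j c k) Q s :=
  ⟨_, ⟨0, fun _ => by simp [Program.exec]⟩, h⟩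

open Classical in
theorem Ensures.fieldTest {a b c : ℕ} {i j k : NatExp} {Q : State F → Prop}
    {s : State F} (h : Q (s.setNat a (i.eval s.nat)
        (if s.fld b (j.eval s.nat) = s.fld c (k.eval s.nat) then 1 else 0) 1)) :
    Ensures box (.fieldTest a i b j c k) Q s :=
  ⟨_, ⟨0, fun _ => by simp [Program.exec]⟩, h⟩

theorem Ensures.query {a b c : ℕ} {e : NatExp} {Q : State F → Prop}
    {s : State F} (h : Q (s.query box a b c (e.eval s.nat))) :
    Ensures box (.query a b c e) Q s :=
  ⟨_, ⟨0, fun _ => by simp [Program.exec]⟩, h⟩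

/-- A loop with invariant `I` and variant `v`. -/
theorem Ensures.loop {e : NatExp} {p : Program} (I : State F → Prop) (v : State F → ℕ)
    (step : ∀ s, I s → e.eval s.nat ≠ 0 → Ensures box p (fun s' => I s' ∧ v s' < v s) s)
    {s : State F} (hs : I s) : Ensures box (.loop e p) (fun s' => I s' ∧ e.eval s'.nat = 0) s := by
  -- The number of rounds left, `r`, decreases, while the cutoff `n` inside the body stays fixed; so
  -- the induction needs separate thresholds for the two.
  suffices h : ∀ k s, v s = k → I s → ∃ s', (∃ n₀ k₀, ∀ n r, execLoop e (p.exec box n) r s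
      = PMF.pure (if n₀ ≤ n ∧ k₀ ≤ r then some s' else none)) ∧ I s' ∧ e.eval s'.nat = 0 by
    obtain ⟨s', ⟨n₀, k₀, h⟩, hI⟩ := h _ s rfl hs
    exact ⟨s', ⟨max n₀ k₀, fun n => by rw [Program.exec, h]; simp⟩, hI⟩
  intro k
  induction k using Nat.strong_induction_on with
  | _ k ih =>
  rintro s rfl hI
  by_cases he : e.eval s.nat = 0
  · refine ⟨s, ⟨0, 0, fun n r => ?_⟩, hI, he⟩
    cases r <;> simp [execLoop, he]
  · obtain ⟨s₁, ⟨n₁, h₁⟩, hI₁, hlt⟩ := step s hI he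
    obtain ⟨s₂, ⟨n₂, k₂, h₂⟩, hI₂⟩ := ih _ hlt s₁ rfl hI₁
    refine ⟨s₂, ⟨max n₁ n₂, k₂ + 1, fun n r => ?_⟩, hI₂⟩
    cases r with
    | zero => simp [execLoop, he]
    | succ r =>
      rw [execLoop, if_neg he, h₁, PMF.pure_bind]
      by_cases h : n₁ ≤ n
      · simp [h, h₂]
      · simp [h]

end Semantics

/-! ### The algorithm -/

/-- Run the programs in a list one after the other. -/
def Program.block : List Program → Program
  | [] => .skip
  | p :: ps => .seq p (block ps)

/-- An integer variable is the first entry of an integer array. -/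
def NatExp.var (a : ℕ) : NatExp := .get a (.lit 0)

namespace SparseInterpolation

open Program NatExp

/-- Let the variable 5 be such that `D < 2 ^ B ≤ 2 * D + 1`, for its value `B`. -/
def initBits : Program := block
  [.assign 6 (lit 0) (lit 1),
   .loop (lt (var 6) (add (var 1) (lit 1))) (block
    [.assign 6 (lit 0) (mul (lit 2) (var 6)),
     .assign 5 (lit 0) (add (var 5) (lit 1))])]

/-- Write the lower coefficients of `X ^ m - 1` and the coefficients of `X` to the field arrays 3
and 4. -/
def initQuery : Program := block
  [.fieldOne 5 (lit 0), .fieldOp .sub 3 (lit 0) 6 (lit 0) 5 (lit 0), .fieldOne 4 (lit 1)]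

/-- The position at which the coefficient number `i` of the remainder modulo `X ^ m - 1` is
stored. -/
def pos (m i : NatExp) : NatExp := add (mul m m) i

/-- Store the answer of a query, and flags for its nonzero coefficients. -/
def store : Program := block
  [.assign 11 (lit 0) (lit 0),
   .loop (lt (var 11) (var 7)) (block
    [.fieldOp .add 1 (pos (var 7) (var 11)) 2 (var 11) 6 (lit 0),
     .fieldTest 10 (pos (var 7) (var 11)) 2 (var 11) 6 (lit 0),
     .assign 10 (pos (var 7) (var 11)) (sub (lit 1) (get 10 (pos (var 7) (var 11)))),
     .assign 11 (lit 0) (add (var 11) (lit 1))])]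

/-- Query the black box for the remainders modulo `X ^ m - 1`, for sufficiently many primes `m` that
do not divide the size of the field. -/
def collect : Program := block
  [.assign 7 (lit 0) (lit 1),
   .assign 8 (lit 0) (lit 1),
   .loop (lt (var 9) (add (mul (lit 2) (mul (var 0) (var 5))) (lit 1))) (block
    [.assign 7 (lit 0) (add (var 7) (lit 1)),
     .ite (mod (mul (mul (var 8) (var 8)) (var 2)) (var 7)) (block
      [.assign 9 (lit 0) (add (var 9) (lit 1)),
       .query 2 3 4 (var 7),
       store]) .skip,
     .assign 8 (lit 0) (mul (var 8) (var 7))])]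

/-- Count the primes for which the remainder has a coefficient that may come from the exponent in
the variable 12. -/
def countVotes : Program := block
  [.assign 13 (lit 0) (lit 0),
   .assign 14 (lit 0) (lit 1),
   .loop (lt (var 14) (add (var 7) (lit 1))) (block
    [.assign 13 (lit 0) (add (var 13) (get 10 (pos (var 14) (mod (var 12) (var 14))))),
     .assign 14 (lit 0) (add (var 14) (lit 1))])]

/-- Find the exponents by majority votes. -/
def findExponents : Program :=
  .loop (lt (var 12) (add (var 1) (lit 1))) (block
    [countVotes,
     .ite (lt (mul (var 0) (var 5)) (var 13)) (block
      [.assign 4 (var 3) (var 12),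
       .assign 3 (lit 0) (add (var 3) (lit 1))]) .skip,
     .assign 12 (lit 0) (add (var 12) (lit 1))])

/-- The difference of two integers, or `1` if they are equal. -/
def dist (a b : NatExp) : NatExp := add (add (sub a b) (sub b a)) (NatExp.eq a b)

/-- Multiply the differences of an exponent and all others. -/
def discriminant : Program := block
  [.assign 15 (lit 0) (lit 1),
   .assign 14 (lit 0) (lit 0),
   .loop (lt (var 14) (var 3)) (block
    [.assign 15 (lit 0) (mul (var 15) (dist (get 4 (var 16)) (get 4 (var 14)))),
     .assign 14 (lit 0) (add (var 14) (lit 1))])]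

/-- Find a prime modulo which an exponent differs from all others. -/
def findPrime : Program := block
  [.assign 14 (lit 0) (lit 1),
   .loop (NatExp.eq (mul (get 10 (pos (var 14) (mod (get 4 (var 16)) (var 14))))
      (mod (var 15) (var 14))) (lit 0))
    (.assign 14 (lit 0) (add (var 14) (lit 1)))]

/-- Read the coefficients. -/
def findCoefficients : Program :=
  .loop (lt (var 16) (var 3)) (block
    [discriminant, findPrime,
     .fieldOp .add 0 (var 16) 1 (pos (var 14) (mod (get 4 (var 16)) (var 14))) 6 (lit 0),
     .assign 16 (lit 0) (add (var 16) (lit 1))])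

/-- The sparse interpolation algorithm.  It makes no random choices, and it examines all exponents
up to the degree bound, as integer computations are free. -/
def program : Program :=
  .ite (var 0) (block [initBits, initQuery, collect, findExponents, findCoefficients]) .skip

end SparseInterpolation

/-! ### Correctness of the parts of the algorithm -/

namespace SparseInterpolation

open Program NatExp

attribute [local simp] State.setNat State.setFld writeEntry NatExp.eval NatExp.var pos FieldOp.eval

theorem polyOfArray_eq_neg_one {F : Type*} [Field F] {u : ℕ → F} (hu : ∀ i, u i = if i = 0 then -1 else 0) {m : ℕ}
    (hm : 0 < m) : polyOfArray u m = -1 := by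
  ext k
  simp only [polyOfArray, finsetSum_coeff, coeff_monomial, Finset.sum_ite_eq', Finset.mem_range, hu,
    coeff_neg, coeff_one]
  split_ifs <;> simp_all

theorem polyOfArray_eq_X {F : Type*} [Field F] {u : ℕ → F} (hu : ∀ i, u i = if i = 1 then 1 else 0) {m : ℕ}
    (hm : 1 < m) : polyOfArray u m = X := by
  ext k
  simp only [polyOfArray, finsetSum_coeff, coeff_monomial, Finset.sum_ite_eq', Finset.mem_range, hu,
    coeff_X]
  by_cases hk : k = 1
  · simp [hk, hm]
  · simp [hk, Ne.symm hk]

/-- The integer arrays of `s` and `s'` agree, except possibly for those in `A`. -/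
def AgreeOff {F : Type*} (A : List ℕ) (s s' : State F) : Prop := ∀ a ∉ A, ∀ i, s'.nat a i = s.nat a i

theorem AgreeOff.refl {F : Type*} (A : List ℕ) (s : State F) : AgreeOff A s s := fun _ _ _ => rfl

theorem AgreeOff.setNat {F : Type*} {A : List ℕ} {s s' : State F} (h : AgreeOff A s s') {a : ℕ} (ha : a ∈ A)
    (i v w : ℕ) : AgreeOff A s (s'.setNat a i v w) := fun b hb j => by
  have : b ≠ a := fun h => hb (h ▸ ha)
  simp [this, h b hb j]

theorem AgreeOff.setFld {F : Type*} {A : List ℕ} {s s' : State F} (h : AgreeOff A s s') (a i : ℕ) (v : F) :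
    AgreeOff A s (s'.setFld a i v) := h

variable {F : Type*} [Field F] [Fintype F] {f : F[X]} {ℓ : ℕ} {box : RemainderBlackBox f ℓ}

theorem ensures_initBits {s : State F} (h5 : s.nat 5 0 = 0) :
    Ensures box initBits (fun s' => AgreeOff [5, 6] s s' ∧ s'.fld = s.fld ∧ s'.cost = s.cost ∧
      s.nat 1 0 < 2 ^ s'.nat 5 0 ∧ 2 ^ s'.nat 5 0 ≤ 2 * s.nat 1 0 + 1) s := by
  refine .seq (.assign (.seq (Ensures.mono (Ensures.loop
    (fun s' => AgreeOff [5, 6] s s' ∧ s'.fld = s.fld ∧ s'.cost = s.cost ∧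
      s'.nat 6 0 = 2 ^ s'.nat 5 0 ∧ 2 ^ s'.nat 5 0 ≤ 2 * s.nat 1 0 + 1)
    (fun s' => s.nat 1 0 + 1 - s'.nat 6 0) ?_ ?_) ?_)))
  · rintro s' ⟨hA, hf, hc, h6, hle⟩ he
    have h1 := hA 1 (by simp) 0
    have hpos : 0 < 2 ^ s'.nat 5 0 := by positivity
    simp [h1, h6] at he
    refine .seq (.assign (.seq (.assign (.skip ⟨⟨(hA.setNat (by simp) _ _ _).setNat (by simp) _ _ _,
      hf, hc, ?_, ?_⟩, ?_⟩))))
    · simp [h6, pow_succ, mul_comm]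
    · simp [pow_succ]
      omega
    · simp [h6]
      omega
  · refine ⟨(AgreeOff.refl _ _).setNat (by simp) _ _ _, rfl, rfl, ?_, ?_⟩ <;>
      simp [h5]
  · rintro s' ⟨⟨hA, hf, hc, h6, hle⟩, he⟩
    have h1 := hA 1 (by simp) 0
    simp [h1, h6] at he
    exact .skip ⟨hA, hf, hc, by omega, hle⟩

open Classical in
-- Copying is done by adding the zero in array 6. Each coefficient costs one addition and one
-- equality test, hence `2 * m`.
theorem ensures_store {s : State F} (h6 : s.fld 6 0 = 0) :
    Ensures box store (fun s' => AgreeOff [10, 11] s s' ∧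
      (∀ x, s'.nat 10 x = if s.nat 7 0 * s.nat 7 0 ≤ x ∧ x < s.nat 7 0 * s.nat 7 0 + s.nat 7 0 then
        if s.fld 2 (x - s.nat 7 0 * s.nat 7 0) ≠ 0 then 1 else 0 else s.nat 10 x) ∧
      (∀ a ≠ 1, s'.fld a = s.fld a) ∧
      (∀ x, s'.fld 1 x = if s.nat 7 0 * s.nat 7 0 ≤ x ∧ x < s.nat 7 0 * s.nat 7 0 + s.nat 7 0 then
        s.fld 2 (x - s.nat 7 0 * s.nat 7 0) else s.fld 1 x) ∧
      s'.cost = s.cost + 2 * s.nat 7 0) s := by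
  set m := s.nat 7 0 with hm
  refine .seq (.assign (.seq (Ensures.mono (Ensures.loop
    (fun s' => AgreeOff [10, 11] s s' ∧ s'.nat 11 0 ≤ m ∧
      (∀ x, s'.nat 10 x = if m * m ≤ x ∧ x < m * m + s'.nat 11 0 then
        if s.fld 2 (x - m * m) ≠ 0 then 1 else 0 else s.nat 10 x) ∧
      (∀ a ≠ 1, s'.fld a = s.fld a) ∧
      (∀ x, s'.fld 1 x = if m * m ≤ x ∧ x < m * m + s'.nat 11 0 then
        s.fld 2 (x - m * m) else s.fld 1 x) ∧
      s'.cost = s.cost + 2 * s'.nat 11 0)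
    (fun s' => m - s'.nat 11 0) ?_ ?_) ?_)))
  · rintro s' ⟨hA, hle, hn, hf, hf1, hc⟩ he
    have h7 : s'.nat 7 0 = m := hA 7 (by simp) 0
    simp [h7] at he
    have e6 : s'.fld 6 0 = 0 := by rw [hf 6 (by decide), h6]
    refine .seq (.fieldOp (.seq (.fieldTest (.seq (.assign (.seq (.assign
      (.skip ⟨⟨?_, ?_, ?_, ?_, ?_, ?_⟩, ?_⟩))))))))
    · exact ((((hA.setFld _ _ _).setNat (by simp) _ _ _).setNat (by simp) _ _ _).setNat
        (by simp) _ _ _)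
    · simp
      omega
    · intro x
      simp [h7, hn, hf, h6]
      by_cases hx : x = m * m + s'.nat 11 0
      · subst hx
        by_cases h0 : s.fld 2 (s'.nat 11 0) = 0 <;> simp [h0]
      · have hiff : (m * m ≤ x ∧ x < m * m + (s'.nat 11 0 + 1)) ↔
            (m * m ≤ x ∧ x < m * m + s'.nat 11 0) := by omega
        simp [hx, hiff]
    · intro a ha
      funext i
      simp [ha, hf]
    · intro x
      simp [h7, e6, hf, hf1]
      by_cases hx : x = m * m + s'.nat 11 0
      · subst hx
        by_cases h0 : s.fld 2 (s'.nat 11 0) = 0 <;> simp [h0]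
      · have hiff : (m * m ≤ x ∧ x < m * m + (s'.nat 11 0 + 1)) ↔
            (m * m ≤ x ∧ x < m * m + s'.nat 11 0) := by omega
        simp [hx, hiff]
    · simp [hc]
      omega
    · simp
      omega
  · refine ⟨(AgreeOff.refl _ _).setNat (by simp) _ _ _, ?_, ?_, ?_, ?_, ?_⟩ <;> simp
  · rintro s' ⟨⟨hA, hle, hn, hf, hf1, hc⟩, he⟩
    have h7 : s'.nat 7 0 = m := hA 7 (by simp) 0
    simp [h7] at he
    obtain h11 : s'.nat 11 0 = m := by omega
    rw [h11] at hn hf1 hc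
    exact .skip ⟨hA, hn, hf, hf1, hc⟩


theorem ensures_initQuery {s : State F} (hs : ∀ a i, s.fld a i = 0) :
    Ensures box initQuery (fun s' => AgreeOff [] s s' ∧ s'.fld 6 0 = 0 ∧
      (∀ i, s'.fld 3 i = if i = 0 then -1 else 0) ∧ (∀ i, s'.fld 4 i = if i = 1 then 1 else 0) ∧
      s'.cost = s.cost + 3) s := by
  refine .seq (.fieldOne (.seq (.fieldOp (.seq (.fieldOne (.skip ⟨AgreeOff.refl _ _, ?_, ?_, ?_,
    ?_⟩))))))
  all_goals simp [hs]

/-- The argument `X` is admissible because a prime exceeds 1, and the modulus `X ^ m - 1` is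
square-free because `m` is nonzero in `F`. -/
theorem query_spec (box : RemainderBlackBox f ℓ) {s : State F} {m : ℕ}
    (hm : GoodPrime (Fintype.card F) m)
    (h3 : ∀ i, s.fld 3 i = if i = 0 then -1 else 0) (h4 : ∀ i, s.fld 4 i = if i = 1 then 1 else 0) :
    (∀ i < m, (s.query box 2 3 4 m).fld 2 i = (f %ₘ (X ^ m - 1)).coeff i) ∧
      (∀ a ≠ 2, (s.query box 2 3 4 m).fld a = s.fld a) ∧
      (s.query box 2 3 4 m).cost ≤ s.cost + ℓ * mulCost F m := by
  have hm2 := hm.1.two_le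
  have hg : (X ^ m + polyOfArray (s.fld 3) m : F[X]) = X ^ m - 1 := by
    rw [polyOfArray_eq_neg_one h3 (by omega), sub_eq_add_neg]
  have hh : polyOfArray (s.fld 4) m = X := polyOfArray_eq_X h4 (by omega)
  have hmonic : (X ^ m - 1 : F[X]).Monic := by
    simpa using monic_X_pow_sub_C (1 : F) (by omega : m ≠ 0)
  have hdeg : (X ^ m - 1 : F[X]).degree = m := by
    simpa using degree_X_pow_sub_C (by omega : 0 < m) (1 : F)
  have hlt : (X : F[X]).degree < (X ^ m - 1 : F[X]).degree := by
    rw [hdeg, degree_X]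
    exact_mod_cast (by omega : 1 < m)
  have hsq : Squarefree (X ^ m - 1 : F[X]) := squarefree_X_pow_sub_one hm.cast_ne_zero
  refine ⟨fun i hi => ?_, fun a ha => ?_, ?_⟩
  · simp only [State.query, hg, hh, hi, and_self, if_true]
    rw [box.answer_eq _ _ hmonic hsq hlt, comp_X]
  · simp [State.query, ha]
  · simp only [State.query, hg, hh]
    have := box.ops_le _ _ hmonic hsq hlt
    rw [natDegree_eq_of_degree_eq_some hdeg] at this
    omega

open Classical in
/-- The state contains the remainders modulo `X ^ m' - 1` for all good primes `m'` up to `m`. -/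
structure Table (f : F[X]) (m : ℕ) (s : State F) : Prop where
  var_eq : s.nat 7 0 = m
  flag : ∀ m' ≥ 1, ∀ i < m', s.nat 10 (m' * m' + i) =
    if m' ∈ goodPrimes (Fintype.card F) m ∧ (f %ₘ (X ^ m' - 1)).coeff i ≠ 0 then 1 else 0
  coeff : ∀ m' ∈ goodPrimes (Fintype.card F) m, ∀ i < m',
    s.fld 1 (m' * m' + i) = (f %ₘ (X ^ m' - 1)).coeff i
  zero : s.fld 6 0 = 0

theorem Table.congr {m : ℕ} {s s' : State F} (h : Table f m s) {A : List ℕ} (hA : AgreeOff A s s')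
    (h7 : 7 ∉ A) (h10 : 10 ∉ A) (hf1 : s'.fld 1 = s.fld 1) (hf6 : s'.fld 6 = s.fld 6) :
    Table f m s' where
  var_eq := by rw [hA 7 h7, h.var_eq]
  flag m' hm' i hi := by rw [hA 10 h10, h.flag m' hm' i hi]
  coeff m' hm' i hi := by rw [hf1, h.coeff m' hm' i hi]
  zero := by rw [hf6, h.zero]

/-- As `m * m + m < (m + 1) * (m + 1)` for `m > 0`, the segments for different moduli are disjoint,
so all remainders fit into one array. -/
theorem sq_add_mem_iff {m m' i : ℕ} (hi : i < m') :
    (m * m ≤ m' * m' + i ∧ m' * m' + i < m * m + m) ↔ m' = m ∧ i < m := by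
  constructor
  · rintro ⟨h1, h2⟩
    have hle : m ≤ m' := by
      by_contra h
      have : (m' + 1) * (m' + 1) ≤ m * m := Nat.mul_self_le_mul_self (by omega)
      have : (m' + 1) * (m' + 1) = m' * m' + 2 * m' + 1 := by ring
      omega
    have hge : m' ≤ m := by
      by_contra h
      have : (m + 1) * (m + 1) ≤ m' * m' := Nat.mul_self_le_mul_self (by omega)
      have : (m + 1) * (m + 1) = m * m + 2 * m + 1 := by ring
      omega
    obtain rfl : m' = m := by omega
    exact ⟨rfl, hi⟩
  · rintro ⟨rfl, -⟩
    omega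

open Classical in
theorem ensures_query_store {s : State F} {m : ℕ} (h7 : s.nat 7 0 = m)
    (hm : GoodPrime (Fintype.card F) m) (h3 : ∀ i, s.fld 3 i = if i = 0 then -1 else 0)
    (h4 : ∀ i, s.fld 4 i = if i = 1 then 1 else 0) (h6 : s.fld 6 0 = 0) :
    Ensures box (block [.query 2 3 4 (var 7), store]) (fun s' => AgreeOff [10, 11] s s' ∧
      (∀ x, s'.nat 10 x = if m * m ≤ x ∧ x < m * m + m then
        if (f %ₘ (X ^ m - 1)).coeff (x - m * m) ≠ 0 then 1 else 0 else s.nat 10 x) ∧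
      s'.fld 3 = s.fld 3 ∧ s'.fld 4 = s.fld 4 ∧ s'.fld 6 = s.fld 6 ∧
      (∀ x, s'.fld 1 x = if m * m ≤ x ∧ x < m * m + m then
        (f %ₘ (X ^ m - 1)).coeff (x - m * m) else s.fld 1 x) ∧
      s'.cost ≤ s.cost + (ℓ * mulCost F m + 2 * m)) s := by
  obtain ⟨hans, hf, hc⟩ := query_spec box hm h3 h4
  have e7 : NatExp.eval s.nat (var 7) = m := by simpa using h7
  refine .seq (.query ?_)
  rw [e7]
  refine .seq ((ensures_store (by rw [hf 6 (by decide), h6])).mono ?_)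
  have hn : (s.query box 2 3 4 m).nat = s.nat := rfl
  rintro s' ⟨hA, h10, hf', hf1, hc'⟩
  rw [hn, h7] at h10 hf1 hc'
  refine .skip ⟨hA, fun x => ?_, ?_, ?_, ?_, fun x => ?_, by omega⟩
  · rw [h10]
    split_ifs with h1 h2 h3 h4
    all_goals first | rfl | (rw [hans _ (by omega)] at *; contradiction)
  · rw [hf' 3 (by decide), hf 3 (by decide)]
  · rw [hf' 4 (by decide), hf 4 (by decide)]
  · rw [hf' 6 (by decide), hf 6 (by decide)]
  · rw [hf1, hf 1 (by decide)]
    split_ifs with h1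
    · exact hans _ (by omega)
    · rfl

theorem goodPrimes_succ_of_not {q m : ℕ} (h : ¬ GoodPrime q (m + 1)) :
    goodPrimes q (m + 1) = goodPrimes q m := by
  ext p
  simp only [mem_goodPrimes]
  constructor
  · rintro ⟨hp, hg⟩
    have : p ≠ m + 1 := fun he => h (he ▸ hg)
    exact ⟨by omega, hg⟩
  · rintro ⟨hp, hg⟩
    exact ⟨by omega, hg⟩

theorem mem_goodPrimes_succ {q m : ℕ} (h : GoodPrime q (m + 1)) {p : ℕ} :
    p ∈ goodPrimes q (m + 1) ↔ p = m + 1 ∨ p ∈ goodPrimes q m := by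
  simp only [mem_goodPrimes]
  constructor
  · rintro ⟨hp, hg⟩
    by_cases he : p = m + 1
    · exact Or.inl he
    · exact Or.inr ⟨by omega, hg⟩
  · rintro (rfl | ⟨hp, hg⟩)
    · exact ⟨le_rfl, h⟩
    · exact ⟨by omega, hg⟩

/-- The bound `M` occurs only in the analysis: the search ends by `M` because enough good primes lie
below it. Only good primes cost field operations, at most `W` each. -/
theorem ensures_collect {s : State F} (h2 : s.nat 2 0 = Fintype.card F) (h9 : s.nat 9 0 = 0)
    (h10 : ∀ i, s.nat 10 i = 0) (h6 : s.fld 6 0 = 0)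
    (h3 : ∀ i, s.fld 3 i = if i = 0 then -1 else 0) (h4 : ∀ i, s.fld 4 i = if i = 1 then 1 else 0)
    {N M W : ℕ} (hN : N = 2 * (s.nat 0 0 * s.nat 5 0) + 1)
    (hM : N ≤ (goodPrimes (Fintype.card F) M).card)
    (hW : ∀ m ≤ M, 0 < m → ℓ * mulCost F m + 2 * m ≤ W) :
    Ensures box collect (fun s' => AgreeOff [7, 8, 9, 10, 11] s s' ∧
      s'.cost ≤ s.cost + N * W ∧
      ∃ m, Table f m s' ∧ (goodPrimes (Fintype.card F) m).card = N) s := by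
  classical
  set q := Fintype.card F with hq
  refine .seq (.assign (.seq (.assign (.seq (Ensures.mono (Ensures.loop
    (fun s' => AgreeOff [7, 8, 9, 10, 11] s s' ∧ (∀ i, s'.fld 3 i = if i = 0 then -1 else 0) ∧
      (∀ i, s'.fld 4 i = if i = 1 then 1 else 0) ∧ Table f (s'.nat 7 0) s' ∧
      1 ≤ s'.nat 7 0 ∧ s'.nat 7 0 ≤ M ∧ s'.nat 8 0 = (s'.nat 7 0).factorial ∧
      s'.nat 9 0 = (goodPrimes q (s'.nat 7 0)).card ∧ s'.nat 9 0 ≤ N ∧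
      s'.cost ≤ s.cost + s'.nat 9 0 * W)
    (fun s' => M - s'.nat 7 0) ?_ ?_) ?_)))))
  · rintro s' ⟨hA, hf3, hf4, hT, hm1, hmM, h8, hcard, hle, hcost⟩ he
    have e0 := hA 0 (by simp) 0
    have e5 := hA 5 (by simp) 0
    have e2 := hA 2 (by simp) 0
    rw [h2] at e2
    simp [e0, e5] at he
    generalize hm : s'.nat 7 0 = m at *
    have hmM' : m < M := by
      by_contra h
      have := Finset.card_le_card (goodPrimes_mono q (not_lt.1 h))
      omega
    have hsucc := card_goodPrimes_succ q m
    -- When the candidate is `m + 1`, variable 8 still holds `m!`, as the test requires.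
    have hgood := goodPrime_iff (q := q) (m := m + 1) (by omega)
    refine .seq (.assign (.seq (.ite ?_ ?_)))
    · intro hc
      simp [h8, hm, e2] at hc
      have hgp : GoodPrime q (m + 1) := hgood.2 (by simpa using hc)
      rw [if_pos hgp] at hsucc
      refine .seq (.assign (Ensures.mono (ensures_query_store (m := m + 1) ?_ hgp ?_ ?_ ?_) ?_))
      · simp [hm]
      · simpa using hf3
      · simpa using hf4
      · simpa using hT.zero
      rintro s₁ ⟨hA₁, h10₁, hf3₁, hf4₁, hf6₁, hf1₁, hc₁⟩
      have e7 : s₁.nat 7 0 = m + 1 := by simp [hA₁ 7 (by simp), hm]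
      have e8 : s₁.nat 8 0 = m.factorial := by simp [hA₁ 8 (by simp), h8]
      have e9 : s₁.nat 9 0 = s'.nat 9 0 + 1 := by simp [hA₁ 9 (by simp)]
      have hW' := hW (m + 1) hmM' (by omega)
      simp at h10₁ hf3₁ hf4₁ hf6₁ hf1₁ hc₁
      refine .seq (.assign (.skip ⟨⟨?_, ?_, ?_, ?_, ?_, ?_, ?_, ?_, ?_, ?_⟩, ?_⟩))
      · refine AgreeOff.setNat (fun a ha i => ?_) (by simp) _ _ _
        rw [hA₁ a (by simp at ha ⊢; tauto)]
        simp at ha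
        simp [ha, hA a (by simpa using ha)]
      · simpa [hf3₁] using hf3
      · simpa [hf4₁] using hf4
      · have h7' : (s₁.setNat 8 (NatExp.eval s₁.nat (lit 0))
            (NatExp.eval s₁.nat ((var 8).mul (var 7))) 0).nat 7 0 = m + 1 := by simp [e7]
        rw [h7']
        refine ⟨h7', fun m' hm' i hi => ?_, fun m' hm' i hi => ?_, ?_⟩
        · have hmem := mem_goodPrimes_succ hgp (p := m')
          have hold := hT.flag m' hm' i hi
          rw [← hq] at hold ⊢
          by_cases he : m' = m + 1
          · subst he
            simp [h10₁, hi, hmem, ite_not]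
          · simp [h10₁, sq_add_mem_iff hi, hmem, he, hold]
        · rw [← hq, mem_goodPrimes_succ hgp] at hm'
          by_cases he : m' = m + 1
          · subst he
            simp [hf1₁, hi]
          · simpa [hf1₁, sq_add_mem_iff hi, he] using hT.coeff m' (hm'.resolve_left he) i hi
        · simpa [hf6₁] using hT.zero
      · simp [e7]
      · simp [e7]
        omega
      · simp [e7, e8, Nat.factorial_succ, mul_comm]
      · simp [e7, e9]
        omega
      · simp [e9]
        omega
      · simp [e9, add_mul]
        omega
      · simp [e7]
        omega
    · intro hc
      simp [h8, hm, e2] at hc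
      have hgp : ¬ GoodPrime q (m + 1) := fun h => hgood.1 h (by simpa using hc)
      rw [if_neg hgp, add_zero] at hsucc
      have hsub := goodPrimes_succ_of_not hgp
      rw [hq] at hsub
      refine .skip (.seq (.assign (.skip ⟨⟨?_, ?_, ?_, ?_, ?_, ?_, ?_, ?_, ?_, ?_⟩, ?_⟩)))
      · exact (hA.setNat (by simp) _ _ _).setNat (by simp) _ _ _
      · simpa using hf3
      · simpa using hf4
      · refine ⟨by simp, fun m' hm' i hi => ?_, fun m' hm' i hi => ?_, ?_⟩
        · simpa [hm, hsub] using hT.flag m' hm' i hi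
        · refine hT.coeff m' ?_ i hi
          simpa [hm, hsub] using hm'
        · simpa using hT.zero
      · simp
      · simp [hm]
        omega
      · simp [hm, h8, Nat.factorial_succ, mul_comm]
      · simp [hm, hcard, hsucc]
      · simpa using hle
      · simpa using hcost
      · simp [hm]
        omega
  · refine ⟨((AgreeOff.refl _ _).setNat (by simp) _ _ _).setNat (by simp) _ _ _, ?_, ?_, ?_, ?_, ?_,
      ?_, ?_, ?_, ?_⟩
    · simpa using h3
    · simpa using h4
    · refine ⟨by simp, fun m' hm' i hi => ?_, fun m' hm' i hi => ?_, ?_⟩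
      · simp [h10, goodPrimes_one]
      · simp [goodPrimes_one] at hm'
      · simpa using h6
    · simp
    · simp
      -- `M = 0` is impossible, since `N ≥ 1` good primes are available up to `M`.
      rcases Nat.eq_zero_or_pos M with rfl | h
      · have := Finset.card_le_card (goodPrimes_mono q (Nat.zero_le 1))
        rw [goodPrimes_one, Finset.card_empty] at this
        omega
      · exact h
    · simp
    · simp [h9, goodPrimes_one]
    · simp [h9]
    · simp [h9]
  · rintro s' ⟨⟨hA, hf3, hf4, hT, hm1, hmM, h8, hcard, hle, hcost⟩, he⟩
    have e0 := hA 0 (by simp) 0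
    have e5 := hA 5 (by simp) 0
    simp [e0, e5] at he
    have h9N : s'.nat 9 0 = N := by omega
    exact .skip ⟨hA, h9N ▸ hcost, _, hT, by rw [← hcard, h9N]⟩

end SparseInterpolation

/-! ### Exponents by majority vote, and the search for isolating primes -/

namespace SparseInterpolation

open Program NatExp

attribute [local simp] State.setNat State.setFld writeEntry NatExp.eval NatExp.var pos FieldOp.eval

theorem AgreeOff.trans {F : Type*} {A A' : List ℕ} {s s' s'' : State F} (h : AgreeOff A s s')
    (h' : AgreeOff A' s' s'') (hA : A' ⊆ A) : AgreeOff A s s'' := fun a ha i => by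
  rw [h' a (fun h => ha (hA h)), h a ha]

theorem goodPrimes_pos {q m p : ℕ} (h : p ∈ goodPrimes q m) : 0 < p :=
  (mem_goodPrimes.1 h).2.1.pos

variable {F : Type*} [Field F] [Fintype F] {f : F[X]} {ℓ : ℕ} {box : RemainderBlackBox f ℓ}

open Classical in
/-- The number of primes that vote for the exponent `e`. -/
noncomputable def votes (f : F[X]) (m e : ℕ) : ℕ :=
  ((goodPrimes (Fintype.card F) m).filter fun p => (f %ₘ (X ^ p - 1)).coeff (e % p) ≠ 0).card

/-- Flags belonging to moduli that are not good primes are zero, so the loop may add over all moduli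
from 1 to `m` without testing them. -/
theorem ensures_countVotes {s : State F} {m : ℕ} (hT : Table f m s) :
    Ensures box countVotes (fun s' => AgreeOff [13, 14] s s' ∧ s'.fld = s.fld ∧
      s'.cost = s.cost ∧ s'.nat 13 0 = votes f m (s.nat 12 0)) s := by
  classical
  set e := s.nat 12 0 with he
  set g : ℕ → ℕ := fun p => if p ∈ goodPrimes (Fintype.card F) m ∧
    (f %ₘ (X ^ p - 1)).coeff (e % p) ≠ 0 then 1 else 0 with hg
  -- The loop starts at 1, the sum over `Finset.range` at 0.
  have hg0 : g 0 = 0 := if_neg fun h => (goodPrimes_pos h.1).ne' rfl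
  have hgv : ∑ p ∈ Finset.range (m + 1), g p = votes f m e := by
    rw [hg, ← Finset.card_filter, votes]
    congr 1
    ext p
    simp only [Finset.mem_filter, Finset.mem_range, mem_goodPrimes]
    constructor
    · rintro ⟨-, h⟩
      exact h
    · exact fun h => ⟨by omega, h⟩
  refine .seq (.assign (.seq (.assign (.seq (Ensures.mono (Ensures.loop
    (fun s' => AgreeOff [13, 14] s s' ∧ s'.fld = s.fld ∧ s'.cost = s.cost ∧ 1 ≤ s'.nat 14 0 ∧
      s'.nat 14 0 ≤ m + 1 ∧ s'.nat 13 0 = ∑ p ∈ Finset.range (s'.nat 14 0), g p)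
    (fun s' => m + 1 - s'.nat 14 0) ?_ ?_) ?_)))))
  · rintro s' ⟨hA, hf, hc, h1, hle, hv⟩ hcond
    have e7 : s'.nat 7 0 = m := by rw [hA 7 (by simp), hT.var_eq]
    have e12 : s'.nat 12 0 = e := hA 12 (by simp) 0
    have e10 := hA 10 (by simp)
    simp [e7] at hcond
    have hflag : _ = g (s'.nat 14 0) :=
      hT.flag (s'.nat 14 0) h1 (e % s'.nat 14 0) (Nat.mod_lt _ h1)
    refine .seq (.assign (.seq (.assign (.skip ⟨⟨(hA.setNat (by simp) _ _ _).setNat (by simp) _ _ _,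
      hf, hc, ?_, ?_, ?_⟩, ?_⟩))))
    · simp
    · simp
      omega
    · simp only [State.setNat, writeEntry, NatExp.eval, NatExp.var, pos, e10, e12, hflag]
      simp [hv, Finset.sum_range_succ]
    · simp
      omega
  · refine ⟨((AgreeOff.refl _ _).setNat (by simp) _ _ _).setNat (by simp) _ _ _, rfl, rfl, ?_, ?_,
      ?_⟩ <;> simp [hg0]
  · rintro s' ⟨⟨hA, hf, hc, h1, hle, hv⟩, hcond⟩
    have e7 : s'.nat 7 0 = m := by rw [hA 7 (by simp), hT.var_eq]
    simp [e7] at hcond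
    obtain h14 : s'.nat 14 0 = m + 1 := by omega
    exact .skip ⟨hA, hf, hc, by rw [hv, h14, hgv]⟩

/-- The first `t` entries of the integer array 4 are the exponents less than `b` of `f`. -/
structure ExponentList (f : F[X]) (b t : ℕ) (s : State F) : Prop where
  coeff_ne_zero : ∀ i < t, f.coeff (s.nat 4 i) ≠ 0
  lt : ∀ i < t, s.nat 4 i < b
  inj : ∀ i < t, ∀ j < t, s.nat 4 i = s.nat 4 j → i = j
  exists_index : ∀ e < b, f.coeff e ≠ 0 → ∃ i < t, s.nat 4 i = e

theorem ensures_findExponents {s : State F} {m : ℕ} (hT : Table f m s) (h3 : s.nat 3 0 = 0)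
    (h12 : s.nat 12 0 = 0)
    (hv : ∀ e ≤ s.nat 1 0, s.nat 0 0 * s.nat 5 0 < votes f m e ↔ f.coeff e ≠ 0) :
    Ensures box findExponents (fun s' => AgreeOff [3, 4, 12, 13, 14] s s' ∧ s'.fld = s.fld ∧
      s'.cost = s.cost ∧ ExponentList f (s.nat 1 0 + 1) (s'.nat 3 0) s') s := by
  refine (Ensures.loop
    (fun s' => AgreeOff [3, 4, 12, 13, 14] s s' ∧ s'.fld = s.fld ∧ s'.cost = s.cost ∧
      s'.nat 12 0 ≤ s.nat 1 0 + 1 ∧ ExponentList f (s'.nat 12 0) (s'.nat 3 0) s')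
    (fun s' => s.nat 1 0 + 1 - s'.nat 12 0) ?_ ?_).mono ?_
  · rintro s' ⟨hA, hf, hc, hle, hL⟩ hcond
    have e1 := hA 1 (by simp) 0
    simp [e1] at hcond
    refine .seq ((ensures_countVotes (hT.congr hA (by simp) (by simp) (by rw [hf])
      (by rw [hf]))).mono ?_)
    rintro s₁ ⟨hA₁, hf₁, hc₁, hv₁⟩
    have hA' : AgreeOff [3, 4, 12, 13, 14] s s₁ := hA.trans hA₁ (by simp)
    have e0 : s₁.nat 0 0 = s.nat 0 0 := hA' 0 (by simp) 0
    have e5 : s₁.nat 5 0 = s.nat 5 0 := hA' 5 (by simp) 0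
    have e3 : s₁.nat 3 0 = s'.nat 3 0 := hA₁ 3 (by simp) 0
    have e4 : ∀ i, s₁.nat 4 i = s'.nat 4 i := hA₁ 4 (by simp)
    have e12 : s₁.nat 12 0 = s'.nat 12 0 := hA₁ 12 (by simp) 0
    have hvote := hv (s'.nat 12 0) (by omega)
    rw [hf] at hf₁
    rw [hc] at hc₁
    generalize s'.nat 12 0 = e at *
    generalize s'.nat 3 0 = t at *
    refine .seq (.ite (fun h => ?_) fun h => ?_)
    · have hne : f.coeff e ≠ 0 := hvote.1 (by simpa [e0, e5, hv₁] using h)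
      refine .seq (.assign (.seq (.assign (.skip (.seq (.assign (.skip ⟨⟨?_, hf₁, hc₁, ?_, ?_⟩,
        ?_⟩)))))))
      · exact ((hA'.setNat (by simp) _ _ _).setNat (by simp) _ _ _).setNat (by simp) _ _ _
      · simp [e12]
        omega
      · simp [e12, e3]
        constructor
        · intro i hi
          by_cases hit : i = t
          · simpa [hit] using hne
          · simpa [hit, e4] using hL.coeff_ne_zero i (by omega)
        · intro i hi
          by_cases hit : i = t
          · simp [hit]
          · simpa [hit, e4] using (hL.lt i (by omega)).trans e.lt_succ_self
        · intro i hi j hj hij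
          by_cases hit : i = t <;> by_cases hjt : j = t
          · omega
          · have := hL.lt j (by omega)
            simp [hit, hjt, e4] at hij
            omega
          · have := hL.lt i (by omega)
            simp [hit, hjt, e4] at hij
            omega
          · exact hL.inj i (by omega) j (by omega) (by simpa [hit, hjt, e4] using hij)
        · intro e' he' hne'
          by_cases hee : e' = e
          · exact ⟨t, by omega, by simp [hee]⟩
          · obtain ⟨i, hi, h⟩ := hL.exists_index e' (by omega) hne'
            exact ⟨i, by omega, by simp [e4, h, show i ≠ t by omega]⟩
      · simp [e12]
        omega
    · simp [e0, e5, hv₁] at h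
      have h0 : f.coeff e = 0 := by
        by_contra hne
        have := hvote.2 hne
        omega
      refine .skip (.seq (.assign (.skip ⟨⟨hA'.setNat (by simp) _ _ _, hf₁, hc₁, ?_, ?_⟩, ?_⟩)))
      · simp [e12]
        omega
      · simp [e12, e3]
        constructor
        · simpa [e4] using hL.coeff_ne_zero
        · simpa [e4] using fun i hi => (hL.lt i hi).trans e.lt_succ_self
        · simpa [e4] using hL.inj
        · intro e' he' hne
          have : e' ≠ e := fun h => hne (h ▸ h0)
          simpa [e4] using hL.exists_index e' (by omega) hne
      · simp [e12]
        omega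
  · refine ⟨AgreeOff.refl _ _, rfl, rfl, by omega, ?_⟩
    rw [h3, h12]
    constructor <;> simp
  · rintro s' ⟨⟨hA, hf, hc, hle, hL⟩, hcond⟩
    have e1 := hA 1 (by simp) 0
    simp [e1] at hcond
    obtain h12 : s'.nat 12 0 = s.nat 1 0 + 1 := by omega
    exact ⟨hA, hf, hc, h12 ▸ hL⟩

/-- The difference of two integers, or `1` if they are equal. -/
def distVal (a b : ℕ) : ℕ := a - b + (b - a) + if a = b then 1 else 0

/-- Equal arguments give the factor 1, so an exponent can be compared with the whole list, itself
included. -/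
theorem dvd_distVal_iff {m a b : ℕ} (hm : m ≠ 1) : m ∣ distVal a b ↔ a ≠ b ∧ a % m = b % m := by
  rw [distVal]
  rcases eq_or_ne a b with rfl | h
  · simpa using hm
  · rw [if_neg h, add_zero]
    rcases le_total a b with hle | hle
    · rw [Nat.sub_eq_zero_of_le hle, zero_add, ← Nat.modEq_iff_dvd' hle]
      simp [h, Nat.ModEq]
    · rw [Nat.sub_eq_zero_of_le hle, add_zero, ← Nat.modEq_iff_dvd' hle]
      simp [h, Nat.ModEq, eq_comm]

theorem ensures_discriminant (s : State F) :
    Ensures box discriminant (fun s' => AgreeOff [14, 15] s s' ∧ s'.fld = s.fld ∧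
      s'.cost = s.cost ∧ s'.nat 15 0 = ∏ j ∈ Finset.range (s.nat 3 0),
        distVal (s.nat 4 (s.nat 16 0)) (s.nat 4 j)) s := by
  refine .seq (.assign (.seq (.assign (.seq (Ensures.mono (Ensures.loop
    (fun s' => AgreeOff [14, 15] s s' ∧ s'.fld = s.fld ∧ s'.cost = s.cost ∧
      s'.nat 14 0 ≤ s.nat 3 0 ∧ s'.nat 15 0 = ∏ j ∈ Finset.range (s'.nat 14 0),
        distVal (s.nat 4 (s.nat 16 0)) (s.nat 4 j))
    (fun s' => s.nat 3 0 - s'.nat 14 0) ?_ ?_) ?_)))))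
  · rintro s' ⟨hA, hf, hc, hle, hR⟩ hcond
    have e3 := hA 3 (by simp) 0
    have e4 := hA 4 (by simp)
    have e16 := hA 16 (by simp) 0
    simp [e3] at hcond
    refine .seq (.assign (.seq (.assign (.skip ⟨⟨(hA.setNat (by simp) _ _ _).setNat (by simp) _ _ _,
      hf, hc, ?_, ?_⟩, ?_⟩))))
    · simp
      omega
    · simp [e4, e16, hR, Finset.prod_range_succ, dist, distVal]
    · simp
      omega
  · refine ⟨((AgreeOff.refl _ _).setNat (by simp) _ _ _).setNat (by simp) _ _ _, rfl, rfl, ?_, ?_⟩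
      <;> simp
  · rintro s' ⟨⟨hA, hf, hc, hle, hR⟩, hcond⟩
    have e3 := hA 3 (by simp) 0
    simp [e3] at hcond
    obtain h14 : s'.nat 14 0 = s.nat 3 0 := by omega
    exact .skip ⟨hA, hf, hc, h14 ▸ hR⟩

/-- The known solution `p` only guarantees termination; the search may stop at a smaller modulus, of
which just the two tested properties are retained. -/
theorem ensures_findPrime {s : State F} {p : ℕ} (hp : 1 ≤ p)
    (hflag : s.nat 10 (p * p + s.nat 4 (s.nat 16 0) % p) ≠ 0) (hR : s.nat 15 0 % p ≠ 0) :
    Ensures box findPrime (fun s' => AgreeOff [14] s s' ∧ s'.fld = s.fld ∧ s'.cost = s.cost ∧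
      1 ≤ s'.nat 14 0 ∧
      s.nat 10 (s'.nat 14 0 * s'.nat 14 0 + s.nat 4 (s.nat 16 0) % s'.nat 14 0) ≠ 0 ∧
      s.nat 15 0 % s'.nat 14 0 ≠ 0) s := by
  refine .seq (.assign (.seq (Ensures.mono (Ensures.loop
    (fun s' => AgreeOff [14] s s' ∧ s'.fld = s.fld ∧ s'.cost = s.cost ∧ 1 ≤ s'.nat 14 0 ∧
      s'.nat 14 0 ≤ p)
    (fun s' => p - s'.nat 14 0) ?_ ?_) ?_)))
  · rintro s' ⟨hA, hf, hc, h1, hle⟩ hcond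
    have e4 := hA 4 (by simp)
    have e10 := hA 10 (by simp)
    have e15 := hA 15 (by simp) 0
    have e16 := hA 16 (by simp) 0
    simp [e4, e10, e15, e16] at hcond
    have hne : s'.nat 14 0 ≠ p := by
      intro h
      rw [h] at hcond
      tauto
    refine .assign ⟨⟨hA.setNat (by simp) _ _ _, hf, hc, ?_, ?_⟩, ?_⟩
    · simp
    · simp
      omega
    · simp
      omega
  · refine ⟨(AgreeOff.refl _ _).setNat (by simp) _ _ _, rfl, rfl, ?_, ?_⟩ <;> simp [hp]
  · rintro s' ⟨⟨hA, hf, hc, h1, hle⟩, hcond⟩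
    have e4 := hA 4 (by simp)
    have e10 := hA 10 (by simp)
    have e15 := hA 15 (by simp) 0
    have e16 := hA 16 (by simp) 0
    simp [e4, e10, e15, e16] at hcond
    exact .skip ⟨hA, hf, hc, h1, by tauto⟩

end SparseInterpolation

/-! ### Reading the coefficients, and the complete program -/

namespace SparseInterpolation

open Program NatExp

attribute [local simp] State.setNat State.setFld writeEntry NatExp.eval NatExp.var pos FieldOp.eval

theorem ExponentList.congr {F : Type*} [Field F] {f : F[X]} {b t : ℕ} {s s' : State F} (h : ExponentList f b t s)
    (h4 : ∀ i, s'.nat 4 i = s.nat 4 i) : ExponentList f b t s' := by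
  obtain ⟨h1, h2, h3, h5⟩ := h
  constructor <;> simpa [h4]

theorem ExponentList.exists_eq {F : Type*} [Field F] {f : F[X]} {b t : ℕ} {s : State F} (h : ExponentList f b t s)
    (hb : f.natDegree < b) {e : ℕ} (he : f.coeff e ≠ 0) : ∃ i < t, s.nat 4 i = e :=
  h.exists_index e ((le_natDegree_of_ne_zero he).trans_lt hb) he

theorem ExponentList.eq_sum {F : Type*} [Field F] {f : F[X]} {b t : ℕ} {s : State F} (h : ExponentList f b t s)
    (hb : f.natDegree < b) :
    f = ∑ i ∈ Finset.range t, monomial (s.nat 4 i) (f.coeff (s.nat 4 i)) := by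
  conv_lhs => rw [f.as_sum_support]
  symm
  refine Finset.sum_bij (fun i _ => s.nat 4 i) (fun i hi => ?_) (fun i hi j hj hij => ?_)
    (fun e he => ?_) fun _ _ => rfl
  · exact mem_support_iff.2 (h.coeff_ne_zero i (Finset.mem_range.1 hi))
  · exact h.inj i (Finset.mem_range.1 hi) j (Finset.mem_range.1 hj) hij
  · obtain ⟨i, hi, rfl⟩ := h.exists_eq hb (mem_support_iff.1 he)
    exact ⟨i, Finset.mem_range.2 hi, rfl⟩

theorem ExponentList.le_card {F : Type*} [Field F] {f : F[X]} {b t : ℕ} {s : State F} (h : ExponentList f b t s) :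
    t ≤ f.support.card := by
  rw [← Finset.card_range t]
  refine Finset.card_le_card_of_injOn (s.nat 4) (fun i hi => ?_) fun i hi j hj hij => ?_
  · exact mem_support_iff.2 (h.coeff_ne_zero i (Finset.mem_range.1 hi))
  · exact h.inj i (Finset.mem_range.1 hi) j (Finset.mem_range.1 hj) hij

/-- A prime isolates an exponent if and only if it does not divide the product of the differences
of this exponent and the others. -/
theorem isolated_iff {F : Type*} [Field F] {f : F[X]} {b t k p : ℕ} {s : State F} (h : ExponentList f b t s) (hb : f.natDegree < b)
    (hp : p.Prime) : (∏ j ∈ Finset.range t, distVal (s.nat 4 k) (s.nat 4 j)) % p ≠ 0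
      ↔ Isolated f (s.nat 4 k) p := by
  rw [Ne, ← Nat.dvd_iff_mod_eq_zero, hp.prime.dvd_finsetProd_iff]
  simp only [dvd_distVal_iff hp.ne_one, Finset.mem_range, not_exists, not_and]
  constructor
  · intro hall e he hne hmod
    obtain ⟨j, hj, rfl⟩ := h.exists_eq hb (mem_support_iff.1 he)
    exact hall j hj hne.symm hmod.symm
  · intro hiso j hj hne hmod
    exact hiso _ (mem_support_iff.2 (h.coeff_ne_zero j hj)) hne.symm hmod.symm

variable {F : Type*} [Field F] [Fintype F] {f : F[X]} {ℓ : ℕ} {box : RemainderBlackBox f ℓ}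

theorem ensures_findCoefficients {s : State F} {m b : ℕ} (hT : Table f m s)
    (hL : ExponentList f b (s.nat 3 0) s) (hb : f.natDegree < b) (h16 : s.nat 16 0 = 0)
    (hiso : ∀ e < b, ∃ p ∈ goodPrimes (Fintype.card F) m, Isolated f e p) :
    Ensures box findCoefficients (fun s' => AgreeOff [14, 15, 16] s s' ∧
      (∀ i < s.nat 3 0, s'.fld 0 i = f.coeff (s.nat 4 i)) ∧ s'.cost = s.cost + s.nat 3 0) s := by
  refine (Ensures.loop
    (fun s' => AgreeOff [14, 15, 16] s s' ∧ (∀ a ≠ 0, s'.fld a = s.fld a) ∧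
      s'.nat 16 0 ≤ s.nat 3 0 ∧ (∀ i < s'.nat 16 0, s'.fld 0 i = f.coeff (s.nat 4 i)) ∧
      s'.cost = s.cost + s'.nat 16 0)
    (fun s' => s.nat 3 0 - s'.nat 16 0) ?_ ?_).mono ?_
  · rintro s' ⟨hA, hf, hle, hout, hc⟩ hcond
    have e3 := hA 3 (by simp) 0
    simp [e3] at hcond
    have hT' := hT.congr hA (by simp) (by simp) (hf 1 (by decide)) (hf 6 (by decide))
    have e4 := hA 4 (by simp)
    have hL' := hL.congr e4
    rw [← e3] at hL'
    generalize hk : s'.nat 16 0 = k at *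
    have hlt := hL.lt k hcond
    have hne := hL.coeff_ne_zero k hcond
    rw [← e4] at hlt hne
    refine .seq ((ensures_discriminant s').mono ?_)
    rintro s₁ ⟨hA₁, hf₁, hc₁, hR⟩
    obtain ⟨p, hp, hpi⟩ := hiso _ hlt
    have e4₁ := hA₁ 4 (by simp)
    have e10₁ := hA₁ 10 (by simp)
    have e16₁ := hA₁ 16 (by simp) 0
    rw [hk] at hR e16₁
    refine .seq ((ensures_findPrime (goodPrimes_pos hp) ?_ ?_).mono ?_)
    · rw [e10₁, e16₁, e4₁, hT'.flag p (goodPrimes_pos hp) _ (Nat.mod_lt _ (goodPrimes_pos hp)),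
        if_pos ⟨hp, by rwa [hpi.coeff_modByMonic (goodPrimes_pos hp)]⟩]
      exact one_ne_zero
    · rw [hR]
      exact (isolated_iff hL' hb (mem_goodPrimes.1 hp).2.1).2 hpi
    · rintro s₂ ⟨hA₂, hf₂, hc₂, h1, hflag, hmod⟩
      generalize hr : s₂.nat 14 0 = r at *
      -- A nonzero flag certifies that `r` is one of the good primes queried; the nonzero residue
      -- then certifies that it isolates the exponent.
      rw [e10₁, e16₁, e4₁, hT'.flag r h1 _ (Nat.mod_lt _ h1)] at hflag
      have hrg : r ∈ goodPrimes (Fintype.card F) m := by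
        by_contra h
        exact hflag (if_neg fun h' => h h'.1)
      rw [hR] at hmod
      have hri := (isolated_iff hL' hb (mem_goodPrimes.1 hrg).2.1).1 hmod
      have hcoeff := hT'.coeff r hrg _ (Nat.mod_lt (s'.nat 4 k) h1)
      rw [hri.coeff_modByMonic h1] at hcoeff
      have e16₂ : s₂.nat 16 0 = k := by rw [hA₂ 16 (by simp), e16₁]
      have e4₂ : s₂.nat 4 k = s'.nat 4 k := by rw [hA₂ 4 (by simp), e4₁]
      have hval : s₂.fld 1 (r * r + s'.nat 4 k % r) + s₂.fld 6 0 = f.coeff (s.nat 4 k) := by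
        rw [hf₂, hf₁, hcoeff, hT'.zero, add_zero, e4]
      rw [hf₁] at hf₂
      refine .seq (.fieldOp (.seq (.assign (.skip ⟨⟨?_, ?_, ?_, ?_, ?_⟩, ?_⟩))))
      · exact (((hA.trans hA₁ (by simp)).trans hA₂ (by simp)).setFld _ _ _).setNat (by simp) _ _ _
      · intro a ha
        funext i
        simp [ha, hf₂, hf]
      · simp [e16₂]
        omega
      · intro i hi
        simp [e16₂] at hi
        by_cases hik : i = k
        · simpa [hik, e16₂, hr, e4₂] using hval
        · simpa [hik, e16₂, hf₂] using hout i (by omega)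
      · simp [e16₂]
        omega
      · simp [e16₂]
        omega
  · exact ⟨AgreeOff.refl _ _, fun _ _ => rfl, by omega, by simp [h16], by omega⟩
  · rintro s' ⟨⟨hA, hf, hle, hout, hc⟩, hcond⟩
    have e3 := hA 3 (by simp) 0
    simp [e3] at hcond
    obtain h : s'.nat 16 0 = s.nat 3 0 := by omega
    rw [h] at hout hc
    exact ⟨hA, hout, hc⟩

/-- The cost consists of 3 operations to set up the queries, at most `W` for each prime, and one
copy for each of at most `T` coefficients. -/
theorem ensures_program {T D : ℕ} (hT : T ≠ 0) (hsupp : f.support.card ≤ T)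
    (hdeg : f.natDegree ≤ D) {M W : ℕ}
    (hM : 2 * (T * Nat.log 2 (2 * D + 1)) + 1 ≤ (goodPrimes (Fintype.card F) M).card)
    (hW : ∀ m ≤ M, 0 < m → ℓ * mulCost F m + 2 * m ≤ W) :
    Ensures box program (fun s' => s'.Outputs f ∧
      s'.cost ≤ 3 + (2 * (T * Nat.log 2 (2 * D + 1)) + 1) * W + T)
      (inputState F T D (Fintype.card F)) := by
  refine .ite (fun _ => ?_) fun h => absurd h (by simpa [inputState] using hT)
  set s₀ := inputState F T D (Fintype.card F) with hs₀
  refine .seq ((ensures_initBits (by simp [hs₀, inputState])).mono ?_)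
  rintro s₁ ⟨hA₁, hf₁, hc₁, hB₁, hB₂⟩
  refine .seq ((ensures_initQuery (by simp [hf₁, hs₀, inputState])).mono ?_)
  rintro s₂ ⟨hA₂, h6, h3, h4, hc₂⟩
  have hA : AgreeOff [5, 6] s₀ s₂ := hA₁.trans hA₂ (by simp)
  have e0 : s₂.nat 0 0 = T := by rw [hA 0 (by simp)]; simp [hs₀, inputState]
  have e1 : s₂.nat 1 0 = D := by rw [hA 1 (by simp)]; simp [hs₀, inputState]
  have e2 : s₂.nat 2 0 = Fintype.card F := by rw [hA 2 (by simp)]; simp [hs₀, inputState]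
  have e3 : s₂.nat 3 0 = 0 := by rw [hA 3 (by simp)]; simp [hs₀, inputState]
  have e9 : s₂.nat 9 0 = 0 := by rw [hA 9 (by simp)]; simp [hs₀, inputState]
  have e10 : ∀ i, s₂.nat 10 i = 0 := fun i => by rw [hA 10 (by simp)]; simp [hs₀, inputState]
  have e12 : s₂.nat 12 0 = 0 := by rw [hA 12 (by simp)]; simp [hs₀, inputState]
  have e16 : s₂.nat 16 0 = 0 := by rw [hA 16 (by simp)]; simp [hs₀, inputState]
  obtain ⟨B, hB⟩ : ∃ B, s₁.nat 5 0 = B := ⟨_, rfl⟩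
  have e5 : s₂.nat 5 0 = B := by rw [hA₂ 5 (by simp), hB]
  have e1' : s₀.nat 1 0 = D := by simp [hs₀, inputState]
  rw [hB, e1'] at hB₁ hB₂
  have hBle : B ≤ Nat.log 2 (2 * D + 1) := Nat.le_log_of_pow_le (by norm_num) hB₂
  have hN : 2 * (T * B) + 1 ≤ 2 * (T * Nat.log 2 (2 * D + 1)) + 1 := by gcongr
  have hcost : s₂.cost = 3 := by rw [hc₂, hc₁]; simp [hs₀, inputState]
  refine .seq ((ensures_collect e2 e9 e10 h6 h3 h4 (by rw [e0, e5]) (hN.trans hM) hW).mono ?_)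
  rintro s₃ ⟨hA₃, hc₃, m, hTab, hcard⟩
  have hpow : ∀ e < D + 1, e < 2 ^ B := fun e he => by omega
  have hpow' : ∀ e ∈ f.support, e < 2 ^ B := fun e he =>
    hpow e (Nat.lt_succ_of_le ((le_natDegree_of_mem_supp e he).trans hdeg))
  have d1 : s₃.nat 1 0 = D := by rw [hA₃ 1 (by simp), e1]
  refine .seq ((ensures_findExponents hTab (by rw [hA₃ 3 (by simp), e3])
    (by rw [hA₃ 12 (by simp), e12]) fun e he => ?_).mono ?_)
  · rw [hA₃ 0 (by simp), hA₃ 5 (by simp), e0, e5]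
    exact lt_votes_iff hsupp hpow' hcard (hpow e (by omega))
  · rintro s₄ ⟨hA₄, hf₄, hc₄, hL⟩
    rw [d1] at hL
    have hlt : f.natDegree < D + 1 := by omega
    refine .seq ((ensures_findCoefficients (hTab.congr hA₄ (by simp) (by simp) (by rw [hf₄])
      (by rw [hf₄])) hL hlt (by rw [hA₄ 16 (by simp), hA₃ 16 (by simp), e16])
      fun e he => exists_isolated hsupp hpow' hcard (hpow e he)).mono ?_)
    rintro s₅ ⟨hA₅, hout, hc₅⟩
    have f3 : s₅.nat 3 0 = s₄.nat 3 0 := hA₅ 3 (by simp) 0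
    have f4 := hA₅ 4 (by simp)
    refine .skip ⟨⟨?_, ?_, ?_⟩, ?_⟩
    · rw [f3]
      exact fun i hi => by rw [hout i hi]; exact hL.coeff_ne_zero i hi
    · rw [f3]
      simpa [f4] using hL.inj
    · rw [f3]
      conv_lhs => rw [hL.eq_sum hlt]
      refine Finset.sum_congr rfl fun i hi => ?_
      rw [f4, hout i (Finset.mem_range.1 hi)]
    · have h1 := hL.le_card
      have h2 : (2 * (T * B) + 1) * W ≤ (2 * (T * Nat.log 2 (2 * D + 1)) + 1) * W :=
        Nat.mul_le_mul_right _ hN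
      rw [hcost] at hc₃
      omega

/-- For `T = 0` the claimed bound is zero, so not a single field operation may be spent; the empty
output is right for `f = 0`. -/
theorem ensures_program_of_eq_zero {s : State F} (hs : s.nat 0 0 = 0) :
    Ensures box program (fun s' => s' = s) s :=
  .ite (fun h => absurd hs (by simpa using h)) fun _ => .skip rfl

end SparseInterpolation

/-! ### The number of field operations -/

theorem log_bound {K M : ℕ} (hK : 0 < K)
    (hM : M ≤ 16 * (7 * K + 2) * (Nat.log 2 (7 * K + 2) + 1)) :
    M ≤ 144 * K * (Nat.log 2 (9 * K) + 1) ∧ Nat.log 2 M + 2 ≤ 12 * (Nat.log 2 (9 * K) + 1) := by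
  have hle : 7 * K + 2 ≤ 9 * K := by omega
  set L := Nat.log 2 (9 * K) + 1 with hL
  have h1 : M ≤ 144 * K * L := by
    calc M ≤ 16 * (7 * K + 2) * (Nat.log 2 (7 * K + 2) + 1) := hM
      _ ≤ 16 * (9 * K) * L := by
        have := Nat.log_mono_right (b := 2) hle
        gcongr
        omega
      _ = _ := by ring
  refine ⟨h1, ?_⟩
  have h2 : 9 * K < 2 ^ L := Nat.lt_pow_succ_log_self (by norm_num) _
  have h3 : L < 2 ^ L := Nat.lt_two_pow_self
  have h4 : M < 2 ^ (2 * L + 8) := by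
    calc M ≤ 16 * (9 * K) * L := h1.trans (le_of_eq (by ring))
      _ ≤ 16 * 2 ^ L * 2 ^ L := by gcongr
      _ = 2 ^ (2 * L + 4) := by ring
      _ < 2 ^ (2 * L + 8) := Nat.pow_lt_pow_right (by norm_num) (by omega)
  have h5 : Nat.log 2 M < 2 * L + 8 := Nat.log_lt_of_lt_pow' (by omega) h4
  omega

/-- There are `O(K)` queries in degree at most `M`, which is `K` up to a logarithm. One logarithm
from `M` and ten from multiplication give the exponent 11. -/
theorem cost_bound_nat {A ℓ K N M T : ℕ} (hℓ : 0 < ℓ) (hK : 0 < K) (hN : N ≤ 7 * K) (hT : T ≤ K)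
    (hM0 : 0 < M) (hM : M ≤ 16 * (7 * K + 2) * (Nat.log 2 (7 * K + 2) + 1)) :
    3 + N * (ℓ * (A * M * (Nat.log 2 M + 2) ^ 10) + 2 * M) + T ≤
      11 * (A + 2) * 144 * 12 ^ 10 * (ℓ * K ^ 2 * (Nat.log 2 (9 * K) + 1) ^ 11) := by
  obtain ⟨h1, h2⟩ := log_bound hK hM
  set L := Nat.log 2 (9 * K) + 1 with hL
  set P := Nat.log 2 M + 2
  have hP : 1 ≤ P ^ 10 := Nat.one_le_pow _ _ (by omega)
  -- The extra 2 in `A + 2` absorbs the `2 * M` operations for storing a remainder.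
  set W := ℓ * ((A + 2) * M * P ^ 10) with hW
  have hW1 : ℓ * (A * M * P ^ 10) + 2 * M ≤ W := by
    have : 1 * (2 * M * 1) ≤ ℓ * (2 * M * P ^ 10) := by gcongr; omega
    calc ℓ * (A * M * P ^ 10) + 2 * M ≤ ℓ * (A * M * P ^ 10) + ℓ * (2 * M * P ^ 10) := by omega
      _ = W := by rw [hW]; ring
  have hW0 : 1 ≤ W := by omega
  have hKW : K ≤ K * W := Nat.le_mul_of_pos_right _ hW0
  calc 3 + N * (ℓ * (A * M * P ^ 10) + 2 * M) + T ≤ 3 + 7 * K * W + K := by gcongr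
    _ ≤ 11 * K * W := by
      have : 7 * K * W = 7 * (K * W) := by ring
      have : 11 * K * W = 11 * (K * W) := by ring
      omega
    _ ≤ 11 * K * (ℓ * ((A + 2) * (144 * K * L) * (12 * L) ^ 10)) := by rw [hW]; gcongr
    _ = _ := by ring

/-- Conversion from integer binary logarithms to real ones, each losing at most a factor 2. The
factor `log (2 / δ)` is merely bounded below by `1 / 2`, as the cost does not depend on chance. -/
theorem cost_bound {ℓ T D : ℕ} (hℓ : 0 < ℓ) (hT : 0 < T) {δ : ℝ} (hδ0 : 0 < δ) (hδ1 : δ < 1) {c : ℝ}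
    (hc : 0 ≤ c) : c * (ℓ * (T * Nat.log 2 (max D 2) : ℕ) ^ 2 *
        (Nat.log 2 (9 * (T * Nat.log 2 (max D 2))) + 1 : ℕ) ^ 11) ≤
      8 * 20 ^ 11 * c * Real.log (2 / δ) *
        (costParam ℓ T D * Real.log (costParam ℓ T D + 2) ^ 11) := by
  have hlog2 : (1 / 2 : ℝ) < Real.log 2 := by
    have := Real.log_two_gt_d9
    linarith
  have hnatlog : ∀ n : ℕ, n ≠ 0 → (Nat.log 2 n : ℝ) ≤ 2 * Real.log n := fun n hn => by
    have h : (2 : ℝ) ^ Nat.log 2 n ≤ n := by exact_mod_cast Nat.pow_log_le_self 2 hn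
    have h' := Real.log_le_log (by positivity) h
    rw [Real.log_pow] at h'
    have : (0 : ℝ) ≤ Nat.log 2 n := Nat.cast_nonneg _
    nlinarith
  set Λ := Nat.log 2 (max D 2) with hΛ
  have hΛ1 : 1 ≤ Λ := Nat.le_log_of_pow_le (by norm_num) (by simp)
  set N₀ := costParam ℓ T D with hN₀
  have hK0 : 1 ≤ T * Λ := Nat.mul_pos hT hΛ1
  have hmain : (ℓ : ℝ) * (T * Λ : ℕ) ^ 2 ≤ 4 * N₀ := by
    have h1 := hnatlog (max D 2) (by simp)
    rw [hN₀, costParam]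
    push_cast
    push_cast at h1
    rw [mul_pow]
    have h2 : (Λ : ℝ) ^ 2 ≤ (2 * Real.log (max (D : ℝ) 2)) ^ 2 := by
      gcongr
    calc (ℓ : ℝ) * ((T : ℝ) ^ 2 * (Λ : ℝ) ^ 2)
        ≤ ℓ * ((T : ℝ) ^ 2 * (2 * Real.log (max (D : ℝ) 2)) ^ 2) := by gcongr
      _ = _ := by ring
  have hKN : ((T * Λ : ℕ) : ℝ) ≤ 4 * N₀ := by
    refine le_trans ?_ hmain
    have h1 : (1 : ℝ) ≤ (T * Λ : ℕ) := by exact_mod_cast hK0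
    have h2 : (1 : ℝ) ≤ ℓ := by exact_mod_cast hℓ
    nlinarith [mul_nonneg (sub_nonneg.2 h2) (sq_nonneg ((T * Λ : ℕ) : ℝ))]
  have hN0 : 0 < N₀ := by
    have h1 : (1 : ℝ) ≤ (T * Λ : ℕ) := by exact_mod_cast hK0
    linarith
  set x := Real.log (N₀ + 2) with hx
  have hx1 : 1 / 2 ≤ x := hlog2.le.trans (Real.log_le_log (by norm_num) (by linarith))
  have hL : ((Nat.log 2 (9 * (T * Λ)) + 1 : ℕ) : ℝ) ≤ 20 * x := by
    have h1 := hnatlog (9 * (T * Λ)) (by omega)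
    have h2 : Real.log ((9 * (T * Λ) : ℕ) : ℝ) ≤ Real.log (2 ^ 6 * (N₀ + 2)) := by
      refine Real.log_le_log (by exact_mod_cast (by omega)) ?_
      rw [Nat.cast_mul]
      push_cast at hKN ⊢
      nlinarith
    rw [Real.log_mul (by norm_num) (by positivity), Real.log_pow] at h2
    have h3 := Real.log_two_lt_d9
    have h4 := Real.log_two_gt_d9
    have h5 : Real.log 2 ≤ x := Real.log_le_log (by norm_num) (by linarith)
    push_cast at h1 h2 ⊢
    linarith
  have hδ : 1 / 2 ≤ Real.log (2 / δ) :=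
    hlog2.le.trans (Real.log_le_log (by norm_num) ((le_div_iff₀ hδ0).2 (by linarith)))
  calc c * (ℓ * (T * Λ : ℕ) ^ 2 * (Nat.log 2 (9 * (T * Λ)) + 1 : ℕ) ^ 11)
      ≤ c * (4 * N₀ * (20 * x) ^ 11) := by gcongr
    _ = 8 * 20 ^ 11 * c * (1 / 2) * (N₀ * x ^ 11) := by ring
    _ ≤ 8 * 20 ^ 11 * c * Real.log (2 / δ) * (N₀ * x ^ 11) := by gcongr

/-! ### The theorem -/

theorem Ensures.toOuterMeasure_eq_one {F : Type*} [Field F] [Fintype F] {f : F[X]} {ℓ : ℕ}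
    {box : RemainderBlackBox f ℓ} {p : Program} {Q : State F → Prop} {s : State F}
    (h : Ensures box p Q s) :
    (∀ n s', some s' ∈ (p.exec box n s).support → Q s') ∧
    (∃ n, (p.exec box n s).toOuterMeasure {r | ∃ s', r = some s' ∧ Q s'} = 1) := by
  obtain ⟨s', ⟨n₀, hr⟩, hQ⟩ := h
  refine ⟨fun n s'' hs => ?_, n₀, ?_⟩
  · rw [hr, PMF.support_pure, Set.mem_singleton_iff] at hs
    split_ifs at hs
    · cases hs
      exact hQ
  · rw [hr, if_pos le_rfl, PMF.toOuterMeasure_pure_apply, if_pos ⟨s', rfl, hQ⟩]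

theorem exists_cost_le : ∃ A : ℕ, ∀ (F : Type u) [Field F] [Fintype F] (T D ℓ : ℕ) (f : F[X])
    (box : RemainderBlackBox f ℓ), 0 < ℓ → f.support.card ≤ T → f.natDegree ≤ D →
    Ensures box SparseInterpolation.program (fun s => s.Outputs f ∧
      s.cost ≤ A * (ℓ * (T * Nat.log 2 (max D 2)) ^ 2 *
        (Nat.log 2 (9 * (T * Nat.log 2 (max D 2))) + 1) ^ 11))
      (inputState F T D (Fintype.card F)) := by
  obtain ⟨A, hA⟩ := exists_mulCost_le.{u}
  refine ⟨11 * (A + 2) * 144 * 12 ^ 10, fun F _ _ T D ℓ f box hℓ hsupp hdeg => ?_⟩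
  rcases Nat.eq_zero_or_pos T with rfl | hT
  · have hf : f = 0 := by simpa using hsupp
    refine (SparseInterpolation.ensures_program_of_eq_zero (by simp [inputState])).mono ?_
    rintro s rfl
    simp [State.Outputs, inputState, hf]
  set K := T * Nat.log 2 (max D 2) with hK
  have hΛ : 1 ≤ Nat.log 2 (max D 2) := Nat.le_log_of_pow_le (by norm_num) (by simp)
  have hTK : T ≤ K := Nat.le_mul_of_pos_right _ hΛ
  -- `2 * D + 1 ≤ 4 * max D 2` adds at most 2 to a logarithm that is at least 1.
  have hB : Nat.log 2 (2 * D + 1) ≤ 3 * Nat.log 2 (max D 2) := by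
    have h1 : 2 * D + 1 ≤ max D 2 * 2 * 2 := by omega
    have h2 := Nat.log_mono_right (b := 2) h1
    rw [Nat.log_mul_base (by norm_num) (by omega), Nat.log_mul_base (by norm_num) (by omega)] at h2
    omega
  set N := 2 * (T * Nat.log 2 (2 * D + 1)) + 1 with hN
  have hN7 : N ≤ 7 * K := by
    have : T * Nat.log 2 (2 * D + 1) ≤ T * (3 * Nat.log 2 (max D 2)) := Nat.mul_le_mul_left _ hB
    have : T * (3 * Nat.log 2 (max D 2)) = 3 * K := by rw [hK]; ring
    omega
  -- More than `N` primes are requested because the characteristic may be among them.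
  obtain ⟨M, hM, hlt⟩ := exists_lt_primeCounting N
  have hM' : M ≤ 16 * (7 * K + 2) * (Nat.log 2 (7 * K + 2) + 1) := hM.trans (by gcongr)
  have hcard := primeCounting_le_card_goodPrimes F M
  have hM0 : 0 < M := Nat.pos_of_ne_zero fun h => by
    subst h
    simp at hlt
  refine (SparseInterpolation.ensures_program (M := M)
    (W := ℓ * (A * M * (Nat.log 2 M + 2) ^ 10) + 2 * M) hT.ne' hsupp hdeg (by omega)
    fun m hm hm0 => ?_).mono ?_
  · have h1 := hA F m hm0
    have h2 := Nat.log_mono_right (b := 2) hm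
    have h3 : A * m * (Nat.log 2 m + 2) ^ 10 ≤ A * M * (Nat.log 2 M + 2) ^ 10 := by gcongr
    gcongr
    exact h1.trans h3
  · rintro s ⟨hout, hcost⟩
    exact ⟨hout, hcost.trans (cost_bound_nat hℓ (by omega) hN7 hTK hM0 hM')⟩

/-- The run is deterministic, so beyond some cutoff all of its probability rests on one correct and
cheap final state, whatever `δ` is. -/
theorem mainTheorem1 :
    ∃ (P : Program) (C : ℝ) (k : ℕ),
      ∀ (F : Type u) [Field F] [Fintype F] (T D ℓ : ℕ) (f : F[X]) (box : RemainderBlackBox f ℓ),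
        T * (T - 1) * D + 1 ≤ Fintype.card F →
        0 < ℓ →
        f.support.card ≤ T →
        f.natDegree ≤ D →
        (∀ (n : ℕ) (s : State F),
          some s ∈ (P.exec box n (inputState F T D (Fintype.card F))).support → s.Outputs f) ∧
        (⨆ n : ℕ, (P.exec box n (inputState F T D (Fintype.card F))).toOuterMeasure
          (Set.range some)) = 1 ∧
        (∀ δ : ℝ, 0 < δ → δ < 1 →
          ∃ n : ℕ, ENNReal.ofReal (1 - δ) ≤
            (P.exec box n (inputState F T D (Fintype.card F))).toOuterMeasure
              {r | ∃ s : State F, r = some s ∧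
                (s.cost : ℝ) ≤ C * Real.log (2 / δ) *
                  (costParam ℓ T D * Real.log (costParam ℓ T D + 2) ^ k)}) := by
  obtain ⟨A, hA⟩ := exists_cost_le.{u}
  refine ⟨SparseInterpolation.program, 8 * 20 ^ 11 * A, 11,
    fun F _ _ T D ℓ f box _ hℓ hsupp hdeg => ?_⟩
  obtain ⟨hout, n₀, hn₀⟩ := (hA F T D ℓ f box hℓ hsupp hdeg).toOuterMeasure_eq_one
  have hle : ∀ (p : PMF (Option (State F))) (S : Set (Option (State F))),
      p.toOuterMeasure S ≤ 1 := fun p S => by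
    rw [PMF.toOuterMeasure_apply, ← p.tsum_coe]
    exact ENNReal.tsum_le_tsum fun r => Set.indicator_le_self _ _ r
  refine ⟨fun n s hs => (hout n s hs).1, le_antisymm (iSup_le fun n => hle _ _) ?_,
    fun δ hδ0 hδ1 => ⟨n₀, ?_⟩⟩
  · refine le_iSup_of_le n₀ (hn₀.symm.le.trans (MeasureTheory.measure_mono ?_))
    rintro r ⟨s, rfl, -⟩
    exact ⟨s, rfl⟩
  · refine (ENNReal.ofReal_le_one.2 (by linarith)).trans (hn₀.symm.le.trans (MeasureTheory.measure_mono ?_))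
    rintro r ⟨s, rfl, -, hcost⟩
    refine ⟨s, rfl, ?_⟩
    rcases Nat.eq_zero_or_pos T with rfl | hT
    · have h0 : s.cost = 0 := by simpa using hcost
      simp [h0, costParam]
    · have h : (s.cost : ℝ) ≤ (A : ℝ) * (ℓ * (T * Nat.log 2 (max D 2) : ℕ) ^ 2 *
          (Nat.log 2 (9 * (T * Nat.log 2 (max D 2))) + 1 : ℕ) ^ 11) := by exact_mod_cast hcost
      exact h.trans (cost_bound hℓ hT hδ0 hδ1 (Nat.cast_nonneg A))
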